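/- **Theorem 3.1 (Local quadratic bracketing).** Setting. Let $p\ge 1$, $\Theta\subseteq\mathbb R^p$, let $\theta^*$ be an interior point of $\Theta$, and let $L(\theta)$, $\theta\in\Theta$, be a real random process on a probability space $(\Omega,\mathcal F,P)$ (the quasi-log-likelihood) with $E|L(\theta)|<\infty$. Put $L(\theta,\theta^*)=L(\theta)-L(\theta^*)$ and $\zeta(\theta)=L(\theta)-EL(\theta)$. Let $V_0^2,D_0^2$ be symmetric positive definite $p\times p$ matrices with symmetric positive definite square roots $V_0,D_0$, let $\nu_0\ge1$, $\mathtt g>0$, and for $r>0$ put $$\Theta_0(r)=\{\theta\in\Theta:\ \|V_0(\theta-\theta^*)\|\le r\}.$$ Let $r^*>0$ be fixed. The conditions are: * $(ED_1)$: for each $0<r\le r^*$ there is a constant $0<\rho(r)\le 1/2$ such that for all $\theta\in\Theta_0(r)$ and all $|\lambda|\le\mathtt g$ $$\sup_{\gamma\ne0}\ \log E\exp\Bigl\{\lambda\,\frac{\gamma^\top(\nabla\zeta(\theta)-\nabla\zeta(\theta^*))}{\rho(r)\,\|V_0\gamma\|}\Bigr\}\le \nu_0^2\lambda^2/2 .$$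 * $(\mathcal L_0)$: for each $0<r\le r^*$ there is a constant $\delta(r)\le 1/2$ such that for all $\theta\in\Theta_0(r)$, $\theta\ne\theta^*$, $$\Bigl|\frac{-2\,EL(\theta,\theta^*)}{\|D_0(\theta-\theta^*)\|^2}-1\Bigr|\le\delta(r).$$ For $\mathfrak d=(\delta,\omega)$ let $D_{\mathfrak d}^2=D_0^2(1-\delta)-\omega V_0^2$, let $D_{\mathfrak d}$ be its nonnegative symmetric square root (when $D_{\mathfrak d}^2\ge0$), and $$\mathbb L_{\mathfrak d}(\theta,\theta^*)=(\theta-\theta^*)^\top\nabla L(\theta^*)-\|D_{\mathfrak d}(\theta-\theta^*)\|^2/2 ;$$ the index $-\mathfrak d=(-\delta,-\omega)$ gives $D_{-\mathfrak d}^2=D_0^2(1+\delta)+\omega V_0^2$ and $\mathbb L_{-\mathfrak d}$. Define the error terms, with values in the extended reals, by $$\diamondsuit_{\pm\mathfrak d}(r)=\sup_{\theta\in\Theta_0(r)}\Bigl\{\pm\bigl[L(\theta,\theta^*)-EL(\theta,\theta^*)-(\theta-\theta^*)^\top\nabla L(\theta^*)\bigr]-\frac{\omega}{2}\|V_0(\theta-\theta^*)\|^2\Bigr\}.$$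 Statement. Assume $(ED_1)$ and $(\mathcal L_0)$. Let $0<r\le r^*$ be such that $\Theta_0(r)$ is convex (for example, the full ellipsoid) and, for every outcome, $\zeta$ is differentiable at every point of $\Theta_0(r)$. Let $\omega\ge3\nu_0\rho(r)$ and $\delta\ge\delta(r)$ be such that $D_0^2(1-\delta)-\omega V_0^2\ge0$. Then: 1. For every outcome and all $\theta\in\Theta_0(r)$, $$\mathbb L_{-\mathfrak d}(\theta,\theta^*)-\diamondsuit_{-\mathfrak d}(r)\ \le\ L(\theta,\theta^*)\ \le\ \mathbb L_{\mathfrak d}(\theta,\theta^*)+\diamondsuit_{\mathfrak d}(r).$$ 2. The two processes have the structure of log-likelihood ratios of linear Gaussian models: with $\xi_{\pm\mathfrak d}=D_{\pm\mathfrak d}^{-1}\nabla L(\theta^*)$, for every outcome and all $\theta\in\mathbb R^p$, $$\mathbb L_{\pm\mathfrak d}(\theta,\theta^*)=\xi_{\pm\mathfrak d}^\top D_{\pm\mathfrak d}(\theta-\theta^*)-\|D_{\pm\mathfrak d}(\theta-\theta^*)\|^2/2 ,$$ where $D_{-\mathfrak d}^2$ is always positive definite, and for the index $+\mathfrak d$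 the identity is asserted whenever $D_{\mathfrak d}^2$ is positive definite. 3. The errors $\diamondsuit_{\mathfrak d}(r)$ and $\diamondsuit_{-\mathfrak d}(r)$ are nonnegative and almost surely finite, and if $\mathtt g_0:=\mathtt g\nu_0\ge3$, then for all $x\ge0$ $$P\{\omega^{-1}\diamondsuit_{\mathfrak d}(r)\ge \mathfrak z(x,Q)\}\le e^{-x},\qquad P\{\omega^{-1}\diamondsuit_{-\mathfrak d}(r)\ge \mathfrak z(x,Q)\}\le e^{-x},$$ where $Q=2p$ for $p\ge2$, $Q=2.7$ for $p=1$, and $$\mathfrak z(x,Q)=\begin{cases}(1+\sqrt{x+Q})^2,&1+\sqrt{x+Q}\le\mathtt g_0,\\ 1+\{2\mathtt g_0^{-1}(x+Q)+\mathtt g_0\}^2,&\text{otherwise.}\end{cases}$$ -/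

import Mathlib

open MeasureTheory ProbabilityTheory
open scoped RealInnerProductSpace MatrixOrder

namespace Bracketing

noncomputable section

/-- The parameter space `ℝ^p` with its Euclidean norm. -/
abbrev Param (p : ℕ) : Type := EuclideanSpace ℝ (Fin p)

/-- `app A h` is the matrix-vector product `A h` in Euclidean space. -/
def app {p : ℕ} (A : Matrix (Fin p) (Fin p) ℝ) (h : Param p) : Param p :=
  Matrix.toEuclideanCLM (𝕜 := ℝ) A h

/-- The local elliptic set `Θ₀(r) = {θ ∈ Θ : ‖V (θ - θ*)‖ ≤ r}`. -/
def localSet {p : ℕ} (Θ : Set (Param p)) (θs : Param p) (V : Matrix (Fin p) (Fin p) ℝ)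
    (r : ℝ) : Set (Param p) :=
  {θ | θ ∈ Θ ∧ ‖app V (θ - θs)‖ ≤ r}

section Quasi

variable {p : ℕ} {Ω : Type*} [MeasurableSpace Ω]

/-- The expected log-likelihood `E L(θ)`. -/
def meanL (P : Measure Ω) (L : Param p → Ω → ℝ) (θ : Param p) : ℝ :=
  ∫ ω, L θ ω ∂P

/-- The stochastic component `ζ(θ) = L(θ) - E L(θ)`. -/
def zeta (P : Measure Ω) (L : Param p → Ω → ℝ) (θ : Param p) (ω : Ω) : ℝ :=
  L θ ω - meanL P L θ

/-- The gradient in `θ` of the stochastic component, `∇ζ(θ)`. -/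
def gradZeta (P : Measure Ω) (L : Param p → Ω → ℝ) (θ : Param p) (ω : Ω) : Param p :=
  gradient (fun θ' => zeta P L θ' ω) θ

/-- The gradient of the log-likelihood at `θ`, `∇L(θ)`. -/
def gradL (L : Param p → Ω → ℝ) (θ : Param p) (ω : Ω) : Param p :=
  gradient (fun θ' => L θ' ω) θ

/-- The log-likelihood ratio `L(θ, θ*) = L(θ) - L(θ*)`. -/
def llr (L : Param p → Ω → ℝ) (θ θs : Param p) (ω : Ω) : ℝ :=
  L θ ω - L θs ω

/-- Condition `(ED₁)`: for each `r ≤ r*` the constant `ρ(r) ∈ (0, 1/2]` is such that, for all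
`θ ∈ Θ₀(r)`, all `γ ≠ 0` and all `|t| ≤ g`,
`log E exp {t γᵀ(∇ζ(θ) - ∇ζ(θ*)) / (ρ(r) ‖V γ‖)} ≤ ν² t² / 2`.
The integrability clause says that the exponential moment is finite. -/
def CondED1 (P : Measure Ω) (Θ : Set (Param p)) (θs : Param p) (L : Param p → Ω → ℝ)
    (V : Matrix (Fin p) (Fin p) ℝ) (ν g rs : ℝ) (ρ : ℝ → ℝ) : Prop :=
  ∀ r : ℝ, 0 < r → r ≤ rs →
    0 < ρ r ∧ ρ r ≤ 1 / 2 ∧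
    ∀ θ ∈ localSet Θ θs V r, ∀ γ : Param p, γ ≠ 0 → ∀ t : ℝ, |t| ≤ g →
      Integrable (fun ω => Real.exp
        (t * (⟪γ, gradZeta P L θ ω - gradZeta P L θs ω⟫ / (ρ r * ‖app V γ‖)))) P ∧
      cgf (fun ω => ⟪γ, gradZeta P L θ ω - gradZeta P L θs ω⟫ / (ρ r * ‖app V γ‖)) P t
        ≤ ν ^ 2 * t ^ 2 / 2

/-- Condition `(L₀)` (local identifiability): for each `r ≤ r*` the constant `δ(r) ≤ 1/2` is such
that `|-2 E L(θ, θ*) / ‖D (θ - θ*)‖² - 1| ≤ δ(r)` for all `θ ∈ Θ₀(r)`, `θ ≠ θ*`. -/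
def CondL0 (P : Measure Ω) (Θ : Set (Param p)) (θs : Param p) (L : Param p → Ω → ℝ)
    (V D : Matrix (Fin p) (Fin p) ℝ) (rs : ℝ) (δr : ℝ → ℝ) : Prop :=
  ∀ r : ℝ, 0 < r → r ≤ rs →
    δr r ≤ 1 / 2 ∧
    ∀ θ ∈ localSet Θ θs V r, θ ≠ θs →
      |(-2 * ∫ ω, llr L θ θs ω ∂P) / ‖app D (θ - θs)‖ ^ 2 - 1| ≤ δr r

/-- The matrix `D_ε² = D² (1 - δ) - w V²` for `ε = (δ, w)`; the matrix for `-ε` is obtained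
from the pair `(-δ, -w)`. -/
def DepsSq (D V : Matrix (Fin p) (Fin p) ℝ) (δ w : ℝ) : Matrix (Fin p) (Fin p) ℝ :=
  (1 - δ) • (D * D) - w • (V * V)

/-- The matrix `D_ε`: the nonnegative symmetric square root of `D_ε²`. -/
def Deps (D V : Matrix (Fin p) (Fin p) ℝ) (δ w : ℝ) : Matrix (Fin p) (Fin p) ℝ :=
  CFC.sqrt (DepsSq D V δ w)

/-- The quadratic process
`𝕃_ε(θ, θ*) = (θ - θ*)ᵀ ∇L(θ*) - ‖D_ε (θ - θ*)‖² / 2`, `ε = (δ, w)`. -/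
def quadProc (L : Param p → Ω → ℝ) (D V : Matrix (Fin p) (Fin p) ℝ) (δ w : ℝ)
    (θ θs : Param p) (ω : Ω) : ℝ :=
  ⟪θ - θs, gradL L θs ω⟫ - ‖app (Deps D V δ w) (θ - θs)‖ ^ 2 / 2

/-- The standardized score `ξ_ε = D_ε⁻¹ ∇L(θ*)`. -/
def xi (L : Param p → Ω → ℝ) (D V : Matrix (Fin p) (Fin p) ℝ) (δ w : ℝ)
    (θs : Param p) (ω : Ω) : Param p :=
  app (Deps D V δ w)⁻¹ (gradL L θs ω)

/-- The upper error `♦_ε(r)`: the supremum over `θ ∈ Θ₀(r)` of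
`L(θ,θ*) - E L(θ,θ*) - (θ - θ*)ᵀ ∇L(θ*) - (w/2) ‖V (θ - θ*)‖²`,
an extended real number. -/
def errUpper (P : Measure Ω) (Θ : Set (Param p)) (θs : Param p) (L : Param p → Ω → ℝ)
    (V : Matrix (Fin p) (Fin p) ℝ) (w r : ℝ) (ω : Ω) : EReal :=
  ⨆ θ ∈ localSet Θ θs V r,
    ((llr L θ θs ω - ∫ ω', llr L θ θs ω' ∂P - ⟪θ - θs, gradL L θs ω⟫
      - w / 2 * ‖app V (θ - θs)‖ ^ 2 : ℝ) : EReal)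

/-- The lower error `♦_{-ε}(r)`: the supremum over `θ ∈ Θ₀(r)` of
`-{L(θ,θ*) - E L(θ,θ*) - (θ - θ*)ᵀ ∇L(θ*)} - (w/2) ‖V (θ - θ*)‖²`,
an extended real number. -/
def errLower (P : Measure Ω) (Θ : Set (Param p)) (θs : Param p) (L : Param p → Ω → ℝ)
    (V : Matrix (Fin p) (Fin p) ℝ) (w r : ℝ) (ω : Ω) : EReal :=
  ⨆ θ ∈ localSet Θ θs V r,
    ((-(llr L θ θs ω - ∫ ω', llr L θ θs ω' ∂P - ⟪θ - θs, gradL L θs ω⟫)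
      - w / 2 * ‖app V (θ - θs)‖ ^ 2 : ℝ) : EReal)

end Quasi

/-- The entropy constant `Q = c₁ p`, with `c₁ = 2` for `p ≥ 2` and `c₁ = 2.7` for `p = 1`. -/
def entropyConst (p : ℕ) : ℝ := (if p = 1 then 2.7 else 2) * (p : ℝ)

/-- The quantile function `z(x, Q)`, depending on the constant `g₀`. -/
def zQ (g₀ x Q : ℝ) : ℝ :=
  if 1 + Real.sqrt (x + Q) ≤ g₀ then (1 + Real.sqrt (x + Q)) ^ 2
  else 1 + (2 * g₀⁻¹ * (x + Q) + g₀) ^ 2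

end

end Bracketing

namespace Bracketing

open Filter Topology

/-! The bracketing inequality is deterministic. By `CondL0.bounds` the mean of the log-likelihood
ratio lies between two multiples of `‖D(θ - θ*)‖²`, and what is left over is exactly the expression
whose supremum defines the error. The Gaussian form is the algebra of a symmetric invertible square
root. The same quadratic bound shows that the mean has zero derivative at `θ*`, so `∇L(θ*) =
∇ζ(θ*)`, and both errors become penalized suprema of plus or minus the remainder `ζ(θ) - ζ(θ*) - (θ
- θ*)ᵀ∇ζ(θ*)`.

The gradient of this remainder is `∇ζ(θ) - ∇ζ(θ*)`, which `(ED₁)` controls. Jensen's inequality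
along segments (`lintegral_exp_sub_le_of_hasDerivAt`) turns this into sub-Gaussian increments of the
normalized remainder in the metric `‖V ·‖`.

Suprema of such fields are bounded by chaining with averages instead of finite nets
(`exp_le_tsum_of_chain`). The field is averaged over homothetic copies of the convex set, shrinking
by a factor 3 per level. Successive averages differ by averages of increments, and the dimension
enters through the density of the rescaled uniform law. The resulting bound on `exp (sup)` is a
measurable variable with expectation at most 1, so Markov's inequality gives a tail bound
(`measure_exists_lt_le`).

The quadratic penalty is handled by peeling into geometric shells
(`measure_exists_quadratic_lt_le`). The condition `w ≥ 3νρ(r)` matches the factor 3 in that lemma,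
and `exists_level_lt_zQ` checks that `zQ` exceeds the level required. -/

/-- Jensen's inequality for the exponential, with values in `ℝ≥0∞`. -/
theorem ofReal_exp_integral_le_lintegral {α : Type*} [MeasurableSpace α] {μ : Measure α}
    [IsProbabilityMeasure μ] {f : α → ℝ} (hf : Integrable f μ) :
    ENNReal.ofReal (Real.exp (∫ x, f x ∂μ)) ≤ ∫⁻ x, ENNReal.ofReal (Real.exp (f x)) ∂μ := by
  by_cases hi : Integrable (fun x => Real.exp (f x)) μ
  · rw [← ofReal_integral_eq_lintegral_ofReal hi (ae_of_all _ fun x => (Real.exp_pos _).le)]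
    exact ENNReal.ofReal_le_ofReal (convexOn_exp.map_integral_le Real.continuous_exp.continuousOn
      isClosed_univ (ae_of_all _ fun _ => Set.mem_univ _) hf hi)
  · have hm : AEStronglyMeasurable (fun x => Real.exp (f x)) μ :=
      Real.continuous_exp.comp_aestronglyMeasurable hf.1
    have : ¬ (∫⁻ x, ENNReal.ofReal (Real.exp (f x)) ∂μ < ⊤) := fun h =>
      hi ⟨hm, (hasFiniteIntegral_iff_ofReal (ae_of_all _ fun x => (Real.exp_pos _).le)).2 h⟩
    rw [not_lt_top_iff.1 this]
    exact le_top

theorem integrable_mul_sub_sub {α : Type*} [MeasurableSpace α] {μ : Measure α}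
    [IsProbabilityMeasure μ] {f g : α → ℝ} (hf : Integrable f μ) (hg : Integrable g μ) (a c : ℝ) :
    Integrable (fun x => a * (f x - g x) - c) μ :=
  ((hf.sub hg).const_mul a).sub (integrable_const c)

theorem integral_mul_sub_sub {α : Type*} [MeasurableSpace α] {μ : Measure α}
    [IsProbabilityMeasure μ] {f g : α → ℝ} (hf : Integrable f μ) (hg : Integrable g μ) (a c : ℝ) :
    ∫ x, (a * (f x - g x) - c) ∂μ = a * (∫ x, f x ∂μ - ∫ x, g x ∂μ) - c := by
  have h : Integrable (fun x => a * (f x - g x)) μ := (hf.sub hg).const_mul a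
  rw [integral_sub h (integrable_const c), integral_const_mul, integral_sub hf hg]
  simp

/-! ### Chaining by averages over a probability measure. -/

section Chaining

variable {C : Type*} [TopologicalSpace C] [CompactSpace C] [SecondCountableTopology C]
  [MeasurableSpace C] [BorelSpace C]

/-- Chaining by averages: a continuous function that vanishes at the root of a chain is controlled
by the exponential moments of its increments along the links of the chain. -/
theorem exp_le_tsum_of_chain (μ : Measure C) [IsProbabilityMeasure μ] {z : C → ℝ}
    (hz : Continuous z) {o : C} (hzo : z o = 0) (m : ℕ → C → C → C) (hm0 : ∀ w u, m 0 w u = o)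
    (hmc : ∀ k, Continuous fun q : C × C => m k q.1 q.2)
    (hlim : ∀ w u, Tendsto (fun k => m k w u) atTop (𝓝 w)) (n : ℕ → ℝ)
    (hdens : ∀ k w, ∀ f : C → ENNReal, Measurable f →
      ∫⁻ u, f (m (k + 1) w u) ∂μ ≤ ENNReal.ofReal (Real.exp (n k)) * ∫⁻ u, f u ∂μ)
    (d : ℕ → ℝ) (hd : ∀ k, 0 < d k) {D Q h : ℝ} (hD : HasSum d D)
    (hQ : HasSum (fun k => d k * n k) (D * Q)) (hh : 0 < h) (v : C) :
    ENNReal.ofReal (Real.exp (h / D * z v - h ^ 2 / 2 - Q)) ≤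
      ∑' k, ENNReal.ofReal (d k / D) * ∫⁻ b, ∫⁻ u,
        ENNReal.ofReal (Real.exp (h / d k * (z b - z (m k b u)) - h ^ 2 / 2)) ∂μ ∂μ := by
  have hDpos : 0 < D := (hd 0).trans_le (hD.tsum_eq ▸ hD.summable.le_tsum 0 fun k _ => (hd k).le)
  obtain ⟨B, hB⟩ : ∃ B, ∀ x, ‖z x‖ ≤ B := by
    obtain ⟨B, hB⟩ := (isCompact_range hz).isBounded.exists_norm_le
    exact ⟨B, fun x => hB _ ⟨x, rfl⟩⟩
  have hzi : ∀ k w, Integrable (fun u => z (m k w u)) μ := fun k w =>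
    Integrable.of_bound ((hz.comp ((hmc k).comp
      (continuous_const.prodMk continuous_id))).aestronglyMeasurable) B (ae_of_all _ fun _ => hB _)
  -- `S k` is `z` smoothed at scale `k`: `S 0 = z o = 0`, and `S k v → z v`. The proof telescopes
  -- between these two.
  set S : ℕ → C → ℝ := fun k w => ∫ u, z (m k w u) ∂μ with hS
  have hSm : ∀ k, StronglyMeasurable (S k) := fun k =>
    StronglyMeasurable.integral_prod_right (f := fun w u => z (m k w u))
      (hz.comp (hmc k)).stronglyMeasurable
  have hSB : ∀ k w, ‖S k w‖ ≤ B := fun k w => by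
    simpa using norm_integral_le_of_norm_le_const (μ := μ) (ae_of_all _ fun u => hB (m k w u))
  have hmw : ∀ k w, Measurable (m k w) := fun k w =>
    ((hmc k).comp (continuous_const.prodMk continuous_id)).measurable
  have hSi : ∀ k j w, Integrable (fun u => S k (m j w u)) μ := fun k j w =>
    Integrable.of_bound ((hSm k).measurable.comp (hmw j w)).aestronglyMeasurable B
      (ae_of_all _ fun _ => hSB _ _)
  set I : ℕ → ENNReal := fun k => ∫⁻ b, ∫⁻ u,
    ENNReal.ofReal (Real.exp (h / d k * (z b - z (m k b u)) - h ^ 2 / 2)) ∂μ ∂μ with hI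
  have key : ∀ k w, ENNReal.ofReal (Real.exp (h / d k * (S (k + 1) w -
      ∫ u, S k (m (k + 1) w u) ∂μ) - h ^ 2 / 2)) ≤ ENNReal.ofReal (Real.exp (n k)) * I k := by
    intro k w
    have e : h / d k * (S (k + 1) w - ∫ u, S k (m (k + 1) w u) ∂μ) - h ^ 2 / 2 =
        ∫ u, (h / d k * (z (m (k + 1) w u) - S k (m (k + 1) w u)) - h ^ 2 / 2) ∂μ := by
      rw [integral_mul_sub_sub (hzi _ _) (hSi _ _ _)]
    rw [e]
    refine (ofReal_exp_integral_le_lintegral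
      (integrable_mul_sub_sub (hzi _ _) (hSi _ _ _) _ _)).trans ?_
    -- The density bound replaces the law of `m (k + 1) w u` by `μ`, at the price `exp (n k)`. The
    -- right-hand side then no longer depends on `w`.
    refine le_trans (lintegral_mono fun u => ?_) (hdens k w (fun b => ∫⁻ u,
      ENNReal.ofReal (Real.exp (h / d k * (z b - z (m k b u)) - h ^ 2 / 2)) ∂μ) ?_)
    · have e2 : h / d k * (z (m (k + 1) w u) - S k (m (k + 1) w u)) - h ^ 2 / 2 =
          ∫ u', (h / d k * (z (m (k + 1) w u) - z (m k (m (k + 1) w u) u')) - h ^ 2 / 2) ∂μ := by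
        rw [integral_mul_sub_sub (integrable_const _) (hzi _ _)]
        simp [hS]
      simp only [e2]
      exact ofReal_exp_integral_le_lintegral
        (integrable_mul_sub_sub (integrable_const _) (hzi _ _) _ _)
    · refine Measurable.lintegral_prod_right' (f := fun q : C × C => ENNReal.ofReal
        (Real.exp (h / d k * (z q.1 - z (m k q.1 q.2)) - h ^ 2 / 2))) ?_
      have h1 := hmc k
      exact (by fun_prop : Continuous fun q : C × C =>
        Real.exp (h / d k * (z q.1 - z (m k q.1 q.2)) - h ^ 2 / 2)).measurable.ennreal_ofReal
  set J : ENNReal := ∑' k, ENNReal.ofReal (d k / D) * I k with hJ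
  by_cases hJt : J = ⊤
  · simp [hJt]
  have hdD : ∀ k, 0 < d k / D := fun k => div_pos (hd k) hDpos
  have hIt : ∀ k, I k ≠ ⊤ := by
    intro k hk
    apply hJt
    rw [hJ]
    refine ENNReal.tsum_eq_top_of_eq_top ⟨k, ?_⟩
    rw [hk, ENNReal.mul_top]
    simpa using hdD k
  have hreal : ∀ k w, Real.exp (h / d k * (S (k + 1) w -
      ∫ u, S k (m (k + 1) w u) ∂μ) - h ^ 2 / 2) ≤ Real.exp (n k) * (I k).toReal := by
    intro k w
    have := key k w
    rwa [← ENNReal.ofReal_toReal (hIt k), ← ENNReal.ofReal_mul (Real.exp_pos _).le,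
      ENNReal.ofReal_le_ofReal_iff (by positivity)] at this
  have hIpos : ∀ k, 0 < (I k).toReal := fun k => by
    have := (Real.exp_pos _).trans_le (hreal k v)
    exact (pos_iff_pos_of_mul_pos this).1 (Real.exp_pos _)
  have hJs : HasSum (fun k => d k / D * (I k).toReal) J.toReal := by
    have := ENNReal.hasSum_toReal hJt
    rw [← ENNReal.tsum_toReal_eq fun k => ENNReal.ne_top_of_tsum_ne_top hJt k] at this
    simpa only [ENNReal.toReal_mul, ENNReal.toReal_ofReal (hdD _).le] using this
  have hA : 0 < J.toReal := (mul_pos (hdD 0) (hIpos 0)).trans_le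
    (hJs.tsum_eq ▸ hJs.summable.le_tsum 0 fun k _ => (mul_pos (hdD k) (hIpos k)).le)
  set A := J.toReal with hAdef
  set c : ℕ → ℝ := fun k => d k / h * (h ^ 2 / 2 + n k + Real.log A - 1 + (I k).toReal / A) with hc
  have hstep : ∀ k w, S (k + 1) w ≤ c k + ∫ u, S k (m (k + 1) w u) ∂μ := by
    intro k w
    set X := S (k + 1) w - ∫ u, S k (m (k + 1) w u) ∂μ with hX
    have h1 := Real.log_le_log (Real.exp_pos _) (hreal k w)
    rw [Real.log_exp, Real.log_mul (Real.exp_pos _).ne' (hIpos k).ne', Real.log_exp] at h1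
    -- The tangent to `log` at the weighted mean `A` of the `I k`. The terms `I k / A - 1` have
    -- weighted sum zero, so summing over `k` leaves just `log A`.
    have h2 := Real.log_le_sub_one_of_pos (div_pos (hIpos k) hA)
    rw [Real.log_div (hIpos k).ne' hA.ne'] at h2
    have h3 : h / d k * X ≤ h ^ 2 / 2 + n k + Real.log A - 1 + (I k).toReal / A := by linarith
    have h4 : X = d k / h * (h / d k * X) := by
      have := (hd k).ne'
      field_simp
    have h5 : X ≤ c k := by
      rw [h4]
      exact mul_le_mul_of_nonneg_left h3 (div_pos (hd k) hh).le
    linarith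
  -- Uniformity in `w` is essential: the induction hypothesis is used at the random point `m (K + 1)
  -- w u`.
  have hind : ∀ K w, S K w ≤ ∑ k ∈ Finset.range K, c k := by
    intro K
    induction K with
    | zero => intro w; simp [hS, hm0, hzo]
    | succ K ih =>
      intro w
      rw [Finset.sum_range_succ, add_comm _ (c K)]
      refine (hstep K w).trans (add_le_add_right ?_ _)
      calc ∫ u, S K (m (K + 1) w u) ∂μ ≤ ∫ _, ∑ k ∈ Finset.range K, c k ∂μ :=
            integral_mono (hSi _ _ _) (integrable_const _) fun u => ih _
        _ = _ := by simp
  have hcs : HasSum c (D / h * (h ^ 2 / 2 + Q + Real.log A)) := by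
    have h1 := (hD.mul_left ((h ^ 2 / 2 + Real.log A - 1) / h)).add
      ((hQ.mul_left (1 / h)).add (hJs.mul_left (D / (h * A))))
    have e1 : (h ^ 2 / 2 + Real.log A - 1) / h * D + (1 / h * (D * Q) + D / (h * A) * A) =
        D / h * (h ^ 2 / 2 + Q + Real.log A) := by
      field_simp
      ring
    rw [e1] at h1
    refine h1.congr_fun fun k => ?_
    simp only [hc]
    field_simp
    ring
  have hSl : Tendsto (fun K => S K v) atTop (𝓝 (z v)) := by
    have := tendsto_integral_of_dominated_convergence (μ := μ) (F := fun K u => z (m K v u))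
      (f := fun _ => z v) (fun _ => B) (fun K => (hzi K v).1) (integrable_const _)
      (fun K => ae_of_all _ fun u => hB _)
      (ae_of_all _ fun u => (hz.tendsto v).comp (hlim v u))
    simpa using this
  have hfin : z v ≤ D / h * (h ^ 2 / 2 + Q + Real.log A) :=
    le_of_tendsto_of_tendsto' hSl hcs.tendsto_sum_nat fun K => hind K v
  have hfin2 : h / D * z v - h ^ 2 / 2 - Q ≤ Real.log A := by
    have := mul_le_mul_of_nonneg_left hfin (div_pos hh hDpos).le
    have e : h / D * (D / h * (h ^ 2 / 2 + Q + Real.log A)) = h ^ 2 / 2 + Q + Real.log A := by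
      field_simp
    linarith
  rw [← ENNReal.ofReal_toReal hJt]
  refine ENNReal.ofReal_le_ofReal ?_
  calc _ ≤ Real.exp (Real.log A) := Real.exp_le_exp.2 hfin2
    _ = A := Real.exp_log hA

/-- Exponential moment of the supremum of a continuous process with sub-Gaussian increments along
the links of a chain. -/
theorem exists_lintegral_le_one_of_chain [TopologicalSpace.MetrizableSpace C]
    {Ω : Type*} [MeasurableSpace Ω] (P : Measure Ω)
    [SFinite P] (μ : Measure C) [IsProbabilityMeasure μ] {Z : C → Ω → ℝ}
    (hZc : ∀ ω, Continuous fun c => Z c ω) (hZm : ∀ c, Measurable (Z c))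
    {o : C} (hZo : ∀ ω, Z o ω = 0) (m : ℕ → C → C → C) (hm0 : ∀ w u, m 0 w u = o)
    (hmc : ∀ k, Continuous fun q : C × C => m k q.1 q.2)
    (hlim : ∀ w u, Tendsto (fun k => m k w u) atTop (𝓝 w)) (n : ℕ → ℝ)
    (hdens : ∀ k w, ∀ f : C → ENNReal, Measurable f →
      ∫⁻ u, f (m (k + 1) w u) ∂μ ≤ ENNReal.ofReal (Real.exp (n k)) * ∫⁻ u, f u ∂μ)
    (d : ℕ → ℝ) (hd : ∀ k, 0 < d k) {D Q h : ℝ} (hD : HasSum d D)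
    (hQ : HasSum (fun k => d k * n k) (D * Q)) (hh : 0 < h)
    (hinc : ∀ k b u, ∫⁻ ω, ENNReal.ofReal (Real.exp (h / d k * (Z b ω - Z (m k b u) ω))) ∂P
      ≤ ENNReal.ofReal (Real.exp (h ^ 2 / 2))) :
    ∃ J : Ω → ENNReal, Measurable J ∧ ∫⁻ ω, J ω ∂P ≤ 1 ∧
      ∀ ω v, ENNReal.ofReal (Real.exp (h / D * Z v ω - h ^ 2 / 2 - Q)) ≤ J ω := by
  have hDpos : 0 < D := (hd 0).trans_le (hD.tsum_eq ▸ hD.summable.le_tsum 0 fun k _ => (hd k).le)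
  have hju : Measurable (Function.uncurry Z) :=
    measurable_uncurry_of_continuous_of_measurable hZc hZm
  set F : ℕ → (C × C) → Ω → ENNReal := fun k q ω => ENNReal.ofReal
    (Real.exp (h / d k * (Z q.1 ω - Z (m k q.1 q.2) ω) - h ^ 2 / 2)) with hF
  have hFm : ∀ k, Measurable (Function.uncurry (F k)) := by
    intro k
    have h1 : Measurable fun x : (C × C) × Ω => Z x.1.1 x.2 :=
      hju.comp (measurable_fst.fst.prodMk measurable_snd)
    have h2 : Measurable fun x : (C × C) × Ω => Z (m k x.1.1 x.1.2) x.2 :=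
      hju.comp (((hmc k).measurable.comp measurable_fst).prodMk measurable_snd)
    exact (((h1.sub h2).const_mul _).sub_const _).exp.ennreal_ofReal
  have hFm' : ∀ k, Measurable (Function.uncurry fun (ω : Ω) (q : C × C) => F k q ω) :=
    fun k => (hFm k).comp measurable_swap
  have hGm : ∀ k, Measurable fun ω => ∫⁻ q, F k q ω ∂(μ.prod μ) :=
    fun k => (hFm' k).lintegral_prod_right'
  -- This majorant is the same for every `v`, so it controls the supremum without any question of
  -- the supremum's measurability. Its mean is at most 1 because the weights `d k / D` sum to 1.
  refine ⟨fun ω => ∑' k, ENNReal.ofReal (d k / D) * ∫⁻ q, F k q ω ∂(μ.prod μ),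
    Measurable.tsum fun k => (hGm k).const_mul _, ?_, ?_⟩
  · rw [lintegral_tsum fun k => ((hGm k).const_mul _).aemeasurable]
    calc ∑' k, ∫⁻ ω, ENNReal.ofReal (d k / D) * ∫⁻ q, F k q ω ∂(μ.prod μ) ∂P
        ≤ ∑' k, ENNReal.ofReal (d k / D) := by
          refine ENNReal.tsum_le_tsum fun k => ?_
          rw [lintegral_const_mul _ (hGm k), lintegral_lintegral_swap (hFm' k).aemeasurable]
          refine mul_le_of_le_one_right' ?_
          calc ∫⁻ q, ∫⁻ ω, F k q ω ∂P ∂(μ.prod μ) ≤ ∫⁻ _, 1 ∂(μ.prod μ) := by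
                refine lintegral_mono fun q => ?_
                have h3 : ∀ ω, F k q ω = ENNReal.ofReal (Real.exp (-(h ^ 2 / 2))) *
                    ENNReal.ofReal (Real.exp (h / d k * (Z q.1 ω - Z (m k q.1 q.2) ω))) := by
                  intro ω
                  rw [← ENNReal.ofReal_mul (Real.exp_pos _).le, ← Real.exp_add]
                  simp only [hF]
                  congr 2
                  ring
                simp only [h3]
                rw [lintegral_const_mul' _ _ ENNReal.ofReal_ne_top]
                refine (mul_le_mul_right (hinc k q.1 q.2) _).trans ?_
                rw [← ENNReal.ofReal_mul (Real.exp_pos _).le, ← Real.exp_add]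
                simp
            _ = 1 := by simp
      _ = 1 := by
          rw [← ENNReal.ofReal_tsum_of_nonneg (fun k => (div_pos (hd k) hDpos).le)
            (hD.div_const D).summable, (hD.div_const D).tsum_eq, div_self hDpos.ne']
          simp
  · intro ω v
    refine (exp_le_tsum_of_chain μ (hZc ω) (hZo ω) m hm0 hmc hlim n hdens d hd hD hQ hh v).trans
      (ENNReal.tsum_le_tsum fun k => ?_)
    have h4 : Measurable fun q => F k q ω := (hFm k).comp measurable_prodMk_right
    rw [lintegral_prod _ h4.aemeasurable]

end Chaining

/-! ### Chaining by homotheties in a convex set. -/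

/-- The uniform distribution on a set. -/
noncomputable def uniformOn {E : Type*} [MeasurableSpace E] (ν : Measure E) (B : Set E) : Measure B :=
  (ν B)⁻¹ • Measure.comap Subtype.val ν

theorem isProbabilityMeasure_uniformOn {E : Type*} [MeasurableSpace E] (ν : Measure E) {B : Set E} (hB : MeasurableSet B)
    (h0 : ν B ≠ 0) (ht : ν B ≠ ⊤) : IsProbabilityMeasure (uniformOn ν B) := by
  constructor
  rw [uniformOn, Measure.smul_apply, (MeasurableEmbedding.subtype_coe hB).comap_apply]
  simp [ENNReal.inv_mul_cancel h0 ht]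

/-- Link lengths of the chain. The first link starts at the centre, at distance at most `R`; later
ones join two points of the set, at distance at most `2R`, hence the factor 2. -/
theorem hasSum_chain_radii (R : ℝ) :
    HasSum (fun k : ℕ => (if k = 0 then 1 else 2) * R * (1 / 3 : ℝ) ^ k) (2 * R) := by
  have h1 := (hasSum_geometric_of_lt_one (r := (1 / 3 : ℝ)) (by norm_num)
    (by norm_num)).mul_left (2 * R)
  have h2 := h1.sub (hasSum_ite_eq (0 : ℕ) R)
  have e : 2 * R * (1 - 1 / 3 : ℝ)⁻¹ - R = 2 * R := by ring
  rw [e] at h2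
  refine h2.congr_fun fun k => ?_
  by_cases hk : k = 0
  · simp [hk]; ring
  · simp [hk]

theorem hasSum_chain_entropy (R q : ℝ) :
    HasSum (fun k : ℕ => (if k = 0 then 1 else 2) * R * (1 / 3 : ℝ) ^ k * ((k + 1) * q))
      (2 * R * (7 / 4 * q)) := by
  have h1 := (hasSum_geometric_of_lt_one (r := (1 / 3 : ℝ)) (by norm_num)
    (by norm_num)).mul_left (2 * R * q)
  have h3 := (hasSum_coe_mul_geometric_of_norm_lt_one (r := (1 / 3 : ℝ))
    (by norm_num)).mul_left (2 * R * q)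
  have h2 := (h1.add h3).sub (hasSum_ite_eq (0 : ℕ) (R * q))
  have e : 2 * R * q * (1 - 1 / 3 : ℝ)⁻¹ + 2 * R * q * (1 / 3 / (1 - 1 / 3) ^ 2) - R * q =
      2 * R * (7 / 4 * q) := by ring
  rw [e] at h2
  refine h2.congr_fun fun k => ?_
  by_cases hk : k = 0
  · simp [hk]; ring
  · simp [hk]; ring

section Convex

variable {E : Type*} [NormedAddCommGroup E] [NormedSpace ℝ E]

/-- The homothety of ratio `c` centred at `w`, evaluated at `u`, within a convex set. -/
def contract {B : Set E} (hB : Convex ℝ B) (c : unitInterval) (w u : B) : B :=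
  ⟨(1 - (c : ℝ)) • (w : E) + (c : ℝ) • (u : E),
    hB w.2 u.2 (sub_nonneg.2 c.2.2) c.2.1 (by ring)⟩

theorem continuous_contract {B : Set E} (hB : Convex ℝ B) (c : unitInterval) :
    Continuous fun q : B × B => contract hB c q.1 q.2 := by
  refine Continuous.subtype_mk ?_ _
  fun_prop

/-- Increments of a random field are sub-Gaussian with respect to the seminorm `‖A ·‖`, for
exponents up to `g`. -/
def SubgaussianIncrements {Ω : Type*} [MeasurableSpace Ω] (P : Measure Ω) (B : Set E)
    (A : E →L[ℝ] E) (g : ℝ) (W : E → Ω → ℝ) : Prop :=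
  ∀ a ∈ B, ∀ b ∈ B, ∀ t : ℝ, 0 < t → t * ‖A (a - b)‖ ≤ g →
    ∫⁻ ω, ENNReal.ofReal (Real.exp (t * (W a ω - W b ω))) ∂P ≤
      ENNReal.ofReal (Real.exp ((t * ‖A (a - b)‖) ^ 2 / 2))

theorem SubgaussianIncrements.mono {Ω : Type*} [MeasurableSpace Ω] {P : Measure Ω} {B B' : Set E}
    {A : E →L[ℝ] E} {g : ℝ} {W : E → Ω → ℝ} (h : SubgaussianIncrements P B A g W) (hB : B' ⊆ B) :
    SubgaussianIncrements P B' A g W :=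
  fun a ha b hb => h a (hB ha) b (hB hb)

variable [FiniteDimensional ℝ E] [MeasurableSpace E] [BorelSpace E]

theorem lintegral_comp_add_smul (ν : Measure E) [ν.IsAddHaarMeasure] {F : E → ENNReal}
    (hF : Measurable F) (x : E) {c : ℝ} (hc : c ≠ 0) :
    ∫⁻ u, F (x + c • u) ∂ν = ENNReal.ofReal |(c ^ Module.finrank ℝ E)⁻¹| * ∫⁻ u, F u ∂ν := by
  have h1 : Measurable fun y => F (x + y) := hF.comp (measurable_const_add x)
  rw [← lintegral_add_left_eq_self (μ := ν) F x,
    ← lintegral_map (f := fun y => F (x + y)) h1 (measurable_const_smul c),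
    Measure.map_addHaar_smul ν hc, lintegral_smul_measure]
  rfl

/-- A homothety of ratio `c` scales volume by `c ^ dim`, and by convexity its image stays in `B`.
The rescaled uniform law thus has density at most `c ^ (-dim)` with respect to the uniform law.
Extending `f` by zero allows integration over the whole space. -/
theorem lintegral_contract_le (ν : Measure E) [ν.IsAddHaarMeasure] {B : Set E}
    (hBm : MeasurableSet B) (hB : Convex ℝ B) {c : unitInterval} (hc : (c : ℝ) ≠ 0) (w : B)
    {f : B → ENNReal} (hf : Measurable f) :
    ∫⁻ u, f (contract hB c w u) ∂(uniformOn ν B) ≤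
      ENNReal.ofReal |((c : ℝ) ^ Module.finrank ℝ E)⁻¹| * ∫⁻ u, f u ∂(uniformOn ν B) := by
  have hemb := MeasurableEmbedding.subtype_coe hBm
  set F : E → ENNReal := Function.extend Subtype.val f 0 with hFdef
  have hF : Measurable F := hemb.measurable_extend hf measurable_const
  have hFf : ∀ u : B, F u = f u := fun u => Subtype.val_injective.extend_apply _ _ u
  have hF0 : ∀ x, x ∉ B → F x = 0 := fun x hx => by
    rw [hFdef, Function.extend_apply' _ _ _ (by rintro ⟨y, rfl⟩; exact hx y.2)]
    rfl
  have h1 : ∫⁻ u, f (contract hB c w u) ∂(Measure.comap Subtype.val ν) ≤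
      ENNReal.ofReal |((c : ℝ) ^ Module.finrank ℝ E)⁻¹| *
        ∫⁻ u, f u ∂(Measure.comap Subtype.val ν) := by
    calc ∫⁻ u, f (contract hB c w u) ∂(Measure.comap Subtype.val ν)
        = ∫⁻ u : B, F ((1 - (c : ℝ)) • (w : E) + (c : ℝ) • (u : E))
            ∂(Measure.comap Subtype.val ν) :=
          lintegral_congr fun u => (hFf (contract hB c w u)).symm
      _ = ∫⁻ u in B, F ((1 - (c : ℝ)) • (w : E) + (c : ℝ) • u) ∂ν :=
          lintegral_subtype_comap hBm fun u => F ((1 - (c : ℝ)) • (w : E) + (c : ℝ) • u)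
      _ ≤ ∫⁻ u, F ((1 - (c : ℝ)) • (w : E) + (c : ℝ) • u) ∂ν := setLIntegral_le_lintegral _ _
      _ = ENNReal.ofReal |((c : ℝ) ^ Module.finrank ℝ E)⁻¹| * ∫⁻ u, F u ∂ν :=
          lintegral_comp_add_smul ν hF _ hc
      _ = ENNReal.ofReal |((c : ℝ) ^ Module.finrank ℝ E)⁻¹| * ∫⁻ u in B, F u ∂ν := by
          rw [← lintegral_indicator hBm]
          congr 2
          ext x
          by_cases hx : x ∈ B
          · simp [hx]
          · simp [hx, hF0 x hx]
      _ = _ := by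
          rw [← lintegral_subtype_comap hBm]
          simp only [hFf]
  simp only [uniformOn, lintegral_smul_measure, smul_eq_mul]
  rw [mul_left_comm]
  exact mul_le_mul_right h1 _

/-- Tail bound for the supremum of a random field over a compact convex set. -/
theorem measure_exists_lt_le_of_isCompact {Ω : Type*} [MeasurableSpace Ω] {P : Measure Ω}
    [SFinite P] {B : Set E} (hBc : IsCompact B) (hB : Convex ℝ B) {o : E} (ho : o ∈ interior B)
    {A : E →L[ℝ] E} {g R h : ℝ} {W : E → Ω → ℝ} (hinc : SubgaussianIncrements P B A g W)
    (hWc : ∀ ω, ContinuousOn (fun a => W a ω) B) (hWm : ∀ a ∈ B, Measurable (W a))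
    (hWo : ∀ ω, W o ω = 0) (hR : 0 < R) (hBR : ∀ a ∈ B, ‖A (a - o)‖ ≤ R) (hh : 0 < h)
    (hhg : h ≤ g) (M : ℝ) :
    P {ω | ∃ a ∈ B, M < W a ω} ≤ ENNReal.ofReal (Real.exp
      (-(h / (2 * R) * M) + h ^ 2 / 2 + 7 / 4 * (Module.finrank ℝ E * Real.log 3))) := by
  have : CompactSpace B := isCompact_iff_compactSpace.1 hBc
  have hBm : MeasurableSet B := hBc.measurableSet
  have hoB : o ∈ B := interior_subset ho
  obtain ⟨ν, hν⟩ : ∃ ν : Measure E, ν.IsAddHaarMeasure := ⟨Measure.addHaar, inferInstance⟩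
  have := isProbabilityMeasure_uniformOn ν hBm
    ((isOpen_interior.measure_pos ν ⟨o, ho⟩).trans_le (measure_mono interior_subset)).ne'
    hBc.measure_lt_top.ne
  set c : ℕ → unitInterval := fun k =>
    ⟨(1 / 3 : ℝ) ^ k, by positivity, pow_le_one₀ (by norm_num) (by norm_num)⟩ with hc
  -- At level 0 the ratio is 1, so the link is its second argument; replacing that by `o` roots
  -- every chain at `o`.
  set m : ℕ → B → B → B := fun k w u => contract hB (c k) w (if k = 0 then ⟨o, hoB⟩ else u) with hm
  have hmc : ∀ k, Continuous fun q : B × B => m k q.1 q.2 := by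
    intro k
    have h1 : Continuous fun q : B × B => if k = 0 then ⟨o, hoB⟩ else q.2 := by
      split_ifs
      exacts [continuous_const, continuous_snd]
    exact (continuous_contract hB (c k)).comp (continuous_fst.prodMk h1)
  have hdiff : ∀ k (b u : B), ‖A ((b : E) - (m k b u : B))‖ ≤
      (if k = 0 then 1 else 2) * R * (1 / 3 : ℝ) ^ k := by
    intro k b u
    have e : (b : E) - (m k b u : B) = ((1 / 3 : ℝ) ^ k) •
        ((b : E) - ((if k = 0 then ⟨o, hoB⟩ else u : B) : E)) := by
      simp only [hm, contract, hc]
      module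
    rw [e, map_smul, norm_smul, Real.norm_of_nonneg (by positivity), mul_comm]
    refine mul_le_mul_of_nonneg_right ?_ (by positivity)
    by_cases hk : k = 0
    · simpa [hk] using hBR b b.2
    · simp only [hk, if_false]
      have : (b : E) - (u : E) = (b - o) - (u - o) := by abel
      rw [this, map_sub]
      linarith [norm_sub_le (A ((b : E) - o)) (A ((u : E) - o)), hBR b b.2, hBR u u.2]
  obtain ⟨J, hJm, hJ1, hJ⟩ := exists_lintegral_le_one_of_chain P (uniformOn ν B)
    (Z := fun a ω => W a ω) (fun ω => (hWc ω).domRestrict) (fun a => hWm a a.2) (o := ⟨o, hoB⟩)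
    hWo m (fun w u => by simp [hm, contract, hc])
    hmc
    (fun w u => by
      rw [tendsto_subtype_rng]
      have h0 : Tendsto (fun k : ℕ => (1 / 3 : ℝ) ^ k) atTop (𝓝 0) :=
        tendsto_pow_atTop_nhds_zero_of_lt_one (by norm_num) (by norm_num)
      have h1 : Tendsto (fun k : ℕ => (1 - (1 / 3 : ℝ) ^ k) • (w : E) + (1 / 3 : ℝ) ^ k • (u : E))
          atTop (𝓝 ((1 - (0 : ℝ)) • (w : E) + (0 : ℝ) • (u : E))) :=
        ((tendsto_const_nhds.sub h0).smul_const _).add (h0.smul_const _)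
      simp only [sub_zero, one_smul, zero_smul, add_zero] at h1
      refine h1.congr' ?_
      filter_upwards [eventually_ne_atTop 0] with k hk
      simp [hm, contract, hc, hk])
    -- The logarithm of the density bound for the ratio `3 ^ (-(k + 1))`.
    (fun k => (k + 1) * (Module.finrank ℝ E * Real.log 3))
    (fun k w f hf => by
      refine (lintegral_contract_le ν hBm hB (c := c (k + 1)) (by simp [hc]) w hf).trans_eq ?_
      congr 2
      rw [abs_of_nonneg (by simp only [hc]; positivity)]
      simp only [hc]
      have : (((k : ℝ) + 1) * (Module.finrank ℝ E * Real.log 3)) =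
          ((k + 1) * Module.finrank ℝ E : ℕ) * Real.log 3 := by push_cast; ring
      rw [this, Real.exp_nat_mul, Real.exp_log (by norm_num), ← pow_mul, one_div, inv_pow, inv_inv])
    (fun k => (if k = 0 then 1 else 2) * R * (1 / 3 : ℝ) ^ k)
    (fun k => by split_ifs <;> positivity) (hasSum_chain_radii R)
    (hasSum_chain_entropy R (Module.finrank ℝ E * Real.log 3)) hh
    (fun k b u => by
      have hd : 0 < (if k = 0 then 1 else 2) * R * (1 / 3 : ℝ) ^ k := by split_ifs <;> positivity
      have hle : h / ((if k = 0 then 1 else 2) * R * (1 / 3 : ℝ) ^ k) *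
          ‖A ((b : E) - (m k b u : B))‖ ≤ h := by
        rw [div_mul_eq_mul_div, div_le_iff₀ hd]
        exact mul_le_mul_of_nonneg_left (hdiff k b u) hh.le
      refine (hinc b b.2 _ (m k b u).2 _ (div_pos hh hd) (hle.trans hhg)).trans ?_
      refine ENNReal.ofReal_le_ofReal (Real.exp_le_exp.2 ?_)
      have := pow_le_pow_left₀ (by positivity) hle 2
      linarith)
  set a : ENNReal := ENNReal.ofReal (Real.exp
    (h / (2 * R) * M - h ^ 2 / 2 - 7 / 4 * (Module.finrank ℝ E * Real.log 3))) with ha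
  have hsub : {ω | ∃ a ∈ B, M < W a ω} ⊆ {ω | a ≤ J ω} := by
    rintro ω ⟨x, hx, hMx⟩
    refine le_trans (ENNReal.ofReal_le_ofReal (Real.exp_le_exp.2 ?_)) (hJ ω ⟨x, hx⟩)
    have := mul_le_mul_of_nonneg_left hMx.le (show 0 ≤ h / (2 * R) by positivity)
    linarith
  refine (measure_mono hsub).trans ?_
  have ha0 : a ≠ 0 := by simp [ha, Real.exp_pos]
  refine (meas_ge_le_lintegral_div hJm.aemeasurable ha0 ENNReal.ofReal_ne_top).trans ?_
  refine (ENNReal.div_le_div_right hJ1 _).trans_eq ?_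
  rw [ha, one_div, ← ENNReal.ofReal_inv_of_pos (Real.exp_pos _), ← Real.exp_neg]
  congr 2
  ring

/-- Tail bound for the supremum of a random field over a bounded convex set. -/
theorem measure_exists_lt_le {Ω : Type*} [MeasurableSpace Ω] {P : Measure Ω}
    [SFinite P] {B : Set E} (hBb : Bornology.IsBounded B) (hB : Convex ℝ B) {o : E}
    (ho : o ∈ interior B)
    {A : E →L[ℝ] E} {g R h : ℝ} {W : E → Ω → ℝ} (hinc : SubgaussianIncrements P B A g W)
    (hWc : ∀ ω, ContinuousOn (fun a => W a ω) B) (hWm : ∀ a ∈ B, Measurable (W a))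
    (hWo : ∀ ω, W o ω = 0) (hR : 0 < R) (hBR : ∀ a ∈ B, ‖A (a - o)‖ ≤ R) (hh : 0 < h)
    (hhg : h ≤ g) (M : ℝ) :
    P {ω | ∃ a ∈ B, M < W a ω} ≤ ENNReal.ofReal (Real.exp
      (-(h / (2 * R) * M) + h ^ 2 / 2 + 7 / 4 * (Module.finrank ℝ E * Real.log 3))) := by
  -- `B` need not be closed. Shrinking its closure towards the interior point `o` by `1 - s n` gives
  -- increasing compact convex subsets of `B`; the shift by 2 keeps `s n` strictly between 0 and 1.
  set s : ℕ → ℝ := fun n => 1 / ((n : ℝ) + 2) with hs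
  have hs0 : ∀ n, 0 < s n := fun n => by simp only [hs]; positivity
  have hs1 : ∀ n, s n < 1 := fun n => by
    simp only [hs]
    rw [div_lt_one (by positivity)]
    have : (0 : ℝ) ≤ n := n.cast_nonneg
    linarith
  have hsl : Tendsto s atTop (𝓝 0) := by
    have := (tendsto_one_div_add_atTop_nhds_zero_nat (𝕜 := ℝ)).comp (tendsto_add_atTop_nat 1)
    refine this.congr fun n => ?_
    simp only [hs, Function.comp]
    push_cast
    ring
  set φ : ℕ → E → E := fun n x => s n • o + (1 - s n) • x with hφ
  set K : ℕ → Set E := fun n => φ n '' closure B with hK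
  have hφc : ∀ n, Continuous (φ n) := fun n => by simp only [hφ]; fun_prop
  have hKc : ∀ n, IsCompact (K n) := fun n =>
    (Metric.isCompact_of_isClosed_isBounded isClosed_closure hBb.closure).image (hφc n)
  have hKB : ∀ n, K n ⊆ B := by
    rintro n _ ⟨x, hx, rfl⟩
    exact interior_subset (hB.combo_interior_closure_mem_interior ho hx (hs0 n)
      (sub_nonneg.2 (hs1 n).le) (by ring))
  have hKconv : ∀ n, Convex ℝ (K n) := by
    intro n
    have : K n = (fun y => s n • o + y) '' ((fun x => (1 - s n) • x) '' closure B) := by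
      rw [Set.image_image]
    rw [this]
    exact (hB.closure.smul _).translate _
  have hoφ : ∀ n, φ n o = o := fun n => by simp only [hφ]; module
  have hKo : ∀ n, o ∈ interior (K n) := by
    intro n
    have hopen : IsOpen (φ n '' interior B) := by
      have h1 : IsOpenMap fun x : E => (1 - s n) • x :=
        isOpenMap_smul₀ (sub_pos.2 (hs1 n)).ne'
      exact (isOpenMap_add_left (s n • o)).comp h1 _ isOpen_interior
    exact interior_maximal (Set.image_mono (interior_subset.trans subset_closure)) hopen
      ⟨o, ho, hoφ n⟩
  have hmono : Monotone K := by
    refine monotone_nat_of_le_succ fun n => ?_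
    rintro _ ⟨x, hx, rfl⟩
    set τ := (1 - s n) / (1 - s (n + 1)) with hτ
    have hp : 0 < 1 - s (n + 1) := sub_pos.2 (hs1 _)
    have hle : s (n + 1) ≤ s n := by
      simp only [hs]
      apply one_div_le_one_div_of_le
      · positivity
      · push_cast; linarith
    have hτ0 : 0 ≤ τ := div_nonneg (sub_nonneg.2 (hs1 n).le) hp.le
    have hτ1 : τ ≤ 1 := by rw [hτ, div_le_one hp]; linarith
    refine ⟨(1 - τ) • o + τ • x, hB.closure (subset_closure (interior_subset ho)) hx
      (by linarith) hτ0 (by ring), ?_⟩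
    have e : (1 - s (n + 1)) * τ = 1 - s n := by rw [hτ]; field_simp
    simp only [hφ, smul_add, smul_smul]
    rw [e, ← add_assoc, ← add_smul]
    congr 2
    linear_combination -e
  have hun : {ω | ∃ a ∈ B, M < W a ω} ⊆ ⋃ n, {ω | ∃ a ∈ K n, M < W a ω} := by
    rintro ω ⟨a, ha, hM⟩
    have hlim : Tendsto (fun n => φ n a) atTop (𝓝[B] a) := by
      refine tendsto_nhdsWithin_iff.2 ⟨?_, Eventually.of_forall fun n =>
        hKB n ⟨a, subset_closure ha, rfl⟩⟩
      have h1 : Tendsto (fun n => s n • o + (1 - s n) • a) atTop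
          (𝓝 ((0 : ℝ) • o + (1 - (0 : ℝ)) • a)) :=
        (hsl.smul_const _).add ((tendsto_const_nhds.sub hsl).smul_const _)
      simpa using h1
    obtain ⟨n, hn⟩ := (((hWc ω a ha).tendsto.comp hlim).eventually (lt_mem_nhds hM)).exists
    exact Set.mem_iUnion.2 ⟨n, φ n a, ⟨a, subset_closure ha, rfl⟩, hn⟩
  refine (measure_mono hun).trans ?_
  have hmono' : Monotone fun n => {ω | ∃ a ∈ K n, M < W a ω} := by
    rintro i j hij ω ⟨a, ha, hM⟩
    exact ⟨a, hmono hij ha, hM⟩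
  -- Continuity from below holds for increasing unions of arbitrary sets, so measurability of the
  -- events is not needed.
  rw [hmono'.measure_iUnion]
  exact iSup_le fun n => measure_exists_lt_le_of_isCompact (hKc n) (hKconv n) (hKo n)
    (hinc.mono (hKB n)) (fun ω => (hWc ω).mono (hKB n)) (fun a ha => hWm a (hKB n ha)) hWo hR
    (fun a ha => hBR a (hKB n ha)) hh hhg M

end Convex

/-! ### Peeling: quadratically penalized suprema. -/

/-- With `y = (7/5)^n`, each step adds `(2/5) y - (2/7) y⁻¹ ≥ 2/5 - 2/7 = 4/35`. -/
theorem two_add_le_pow_add_inv_pow (n : ℕ) :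
    2 + 4 / 35 * (n : ℝ) ≤ (7 / 5 : ℝ) ^ n + ((7 / 5 : ℝ) ^ n)⁻¹ := by
  induction n with
  | zero => norm_num
  | succ n ih =>
    have h1 : (1 : ℝ) ≤ (7 / 5 : ℝ) ^ n := one_le_pow₀ (by norm_num)
    have h2 : ((7 / 5 : ℝ) ^ n)⁻¹ ≤ 1 := inv_le_one_of_one_le₀ h1
    rw [pow_succ, mul_inv]
    push_cast
    linarith

/-- Makes the shell probabilities summable. The threshold `35/9` is chosen so that `(3/4) · (4/35) ·
l ≥ 1/3`, and `exp (-1/3) ≤ 3/4`. -/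
theorem exp_shell_le {l : ℝ} (hl : 35 / 9 ≤ l) (n : ℕ) :
    Real.exp (-(3 / 4 * l * ((7 / 5 : ℝ) ^ n + ((7 / 5 : ℝ) ^ n)⁻¹))) ≤
      Real.exp (-(3 / 2 * l)) * (3 / 4 : ℝ) ^ n := by
  have h1 : Real.exp (-(1 / 3 : ℝ)) ≤ 3 / 4 := by
    rw [Real.exp_neg, inv_le_comm₀ (Real.exp_pos _) (by norm_num)]
    have := Real.add_one_le_exp (1 / 3 : ℝ)
    linarith
  calc _ ≤ Real.exp (-(3 / 2 * l) + n * (-(1 / 3 : ℝ))) := by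
        refine Real.exp_le_exp.2 ?_
        have h2 := mul_le_mul_of_nonneg_left (two_add_le_pow_add_inv_pow n)
          (show 0 ≤ 3 / 4 * l by linarith)
        have h3 := mul_le_mul_of_nonneg_right hl n.cast_nonneg
        linarith
    _ = Real.exp (-(3 / 2 * l)) * Real.exp (-(1 / 3 : ℝ)) ^ n := by
        rw [Real.exp_add, Real.exp_nat_mul]
    _ ≤ _ := by gcongr

/-- Tail bound for the supremum of a quadratically penalized random field over a convex set. -/
theorem measure_exists_quadratic_lt_le {E : Type*} [NormedAddCommGroup E] [NormedSpace ℝ E]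
    [FiniteDimensional ℝ E] [MeasurableSpace E] [BorelSpace E] {Ω : Type*} [MeasurableSpace Ω]
    {P : Measure Ω} [SFinite P] {B : Set E} (hBb : Bornology.IsBounded B) (hB : Convex ℝ B) {o : E}
    (ho : o ∈ interior B) {A : E →L[ℝ] E} (hA : Function.Injective A) {g a l : ℝ}
    {W : E → Ω → ℝ} (hinc : SubgaussianIncrements P B A g W)
    (hWc : ∀ ω, ContinuousOn (fun a => W a ω) B) (hWm : ∀ a ∈ B, Measurable (W a))
    (hWo : ∀ ω, W o ω = 0) (ha : 0 < a) (hl : 0 < l) (hlg : l ≤ g) (hla : 35 / 9 ≤ l * a) :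
    P {ω | ∃ x ∈ B, 3 * (a ^ 2 + ‖A (x - o)‖ ^ 2 / 2) < W x ω} ≤ ENNReal.ofReal (8 * Real.exp
      (7 / 4 * (Module.finrank ℝ E * Real.log 3) + l ^ 2 / 2 - 3 / 2 * (l * a))) := by
  set q := 7 / 4 * (Module.finrank ℝ E * Real.log 3) with hq
  -- With radius `2ay` and level `3a²(1 + y²)` the chaining exponent is `-(3/4) l a (y + y⁻¹)`,
  -- largest at `y = 1`, where it equals `-(3/2) l a`.
  set S : ℝ → Set Ω := fun y =>
    {ω | ∃ x ∈ {x ∈ B | ‖A (x - o)‖ ≤ 2 * a * y}, 3 * a ^ 2 * (1 + y ^ 2) < W x ω} with hS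
  have hSP : ∀ y, 0 < y → P (S y) ≤
      ENNReal.ofReal (Real.exp (-(3 / 4 * (l * a) * (y + y⁻¹)) + l ^ 2 / 2 + q)) := by
    intro y hy
    have hconv : Convex ℝ {x ∈ B | ‖A (x - o)‖ ≤ 2 * a * y} := by
      have h1 : Convex ℝ {x : E | ‖A (x - o)‖ ≤ 2 * a * y} := by
        have : {x : E | ‖A (x - o)‖ ≤ 2 * a * y} = A ⁻¹' Metric.closedBall (A o) (2 * a * y) := by
          ext x
          simp [dist_eq_norm, map_sub]
        rw [this]
        exact (convex_closedBall _ _).linear_preimage A.toLinearMap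
      exact hB.inter h1
    have hint : o ∈ interior {x ∈ B | ‖A (x - o)‖ ≤ 2 * a * y} := by
      rw [mem_interior_iff_mem_nhds] at ho ⊢
      have hc : Continuous fun x => ‖A (x - o)‖ := by fun_prop
      have h2 : ∀ᶠ x in 𝓝 o, ‖A (x - o)‖ < 2 * a * y :=
        hc.continuousAt.eventually (gt_mem_nhds (by simp; positivity))
      filter_upwards [ho, h2] with x h3 h4 using ⟨h3, h4.le⟩
    have hsub : {x ∈ B | ‖A (x - o)‖ ≤ 2 * a * y} ⊆ B := fun x hx => hx.1
    refine (measure_exists_lt_le (hBb.subset hsub) hconv hint (hinc.mono hsub)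
      (fun ω => (hWc ω).mono hsub) (fun x hx => hWm x hx.1) hWo
      (show 0 < 2 * a * y by positivity) (fun x hx => hx.2) hl hlg _).trans_eq ?_
    congr 2
    rw [← hq]
    field_simp
    ring
  have hsub : {ω | ∃ x ∈ B, 3 * (a ^ 2 + ‖A (x - o)‖ ^ 2 / 2) < W x ω} ⊆
      ⋃ n : ℕ, (S ((7 / 5 : ℝ) ^ n) ∪ S ((7 / 5 : ℝ) ^ n)⁻¹) := by
    rintro ω ⟨x, hx, hlt⟩
    -- The centre lies in no shell, but there the field vanishes and cannot exceed the positive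
    -- level.
    have hN : 0 < ‖A (x - o)‖ := by
      rw [norm_pos_iff]
      intro h0
      have hxo : x = o := sub_eq_zero.1 (hA (h0.trans (map_zero A).symm))
      rw [hxo, hWo ω] at hlt
      nlinarith [sq_nonneg a, sq_nonneg ‖A (o - o)‖]
    obtain ⟨j, hj1, hj2⟩ := exists_mem_Ioc_zpow (x := ‖A (x - o)‖ / (2 * a)) (y := (7 / 5 : ℝ))
      (by positivity) (by norm_num)
    have hmem : ω ∈ S ((7 / 5 : ℝ) ^ (j + 1)) := by
      refine ⟨x, ⟨hx, ?_⟩, ?_⟩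
      · rwa [div_le_iff₀ (by positivity), mul_comm] at hj2
      · refine lt_of_le_of_lt ?_ hlt
        rw [lt_div_iff₀ (by positivity)] at hj1
        rw [zpow_add_one₀ (by norm_num)]
        set y := (7 / 5 : ℝ) ^ j
        have hy : 0 < y := by positivity
        have h5 : (y * (2 * a)) ^ 2 ≤ ‖A (x - o)‖ ^ 2 :=
          pow_le_pow_left₀ (by positivity) hj1.le 2
        -- The shell ratio `7/5` is below `√2`: the penalty at the inner radius is `6a²y²`, which
        -- dominates `3a²(7y/5)²`.
        nlinarith [mul_pos (pow_pos hy 2) (pow_pos ha 2)]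
    rw [Set.mem_iUnion]
    refine ⟨(j + 1).natAbs, ?_⟩
    rcases Int.natAbs_eq (j + 1) with h | h
    · left
      rwa [h, zpow_natCast] at hmem
    · right
      rwa [h, zpow_neg, zpow_natCast] at hmem
  have hb : ∀ n : ℕ, P (S ((7 / 5 : ℝ) ^ n) ∪ S ((7 / 5 : ℝ) ^ n)⁻¹) ≤ ENNReal.ofReal
      (2 * Real.exp (q + l ^ 2 / 2 - 3 / 2 * (l * a)) * (3 / 4 : ℝ) ^ n) := by
    intro n
    have hy : 0 < (7 / 5 : ℝ) ^ n := by positivity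
    have h1 : Real.exp (-(3 / 4 * (l * a) * ((7 / 5 : ℝ) ^ n + ((7 / 5 : ℝ) ^ n)⁻¹)) + l ^ 2 / 2 + q)
        ≤ Real.exp (q + l ^ 2 / 2 - 3 / 2 * (l * a)) * (3 / 4 : ℝ) ^ n := by
      have h2 := mul_le_mul_of_nonneg_right (exp_shell_le hla n) (Real.exp_pos (q + l ^ 2 / 2)).le
      rw [← Real.exp_add] at h2
      rw [add_assoc, add_comm (l ^ 2 / 2) q]
      refine h2.trans_eq ?_
      rw [mul_right_comm, ← Real.exp_add]
      ring_nf
    refine (measure_union_le _ _).trans ?_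
    rw [mul_assoc, two_mul, ENNReal.ofReal_add (by positivity) (by positivity)]
    refine add_le_add ((hSP _ hy).trans (ENNReal.ofReal_le_ofReal h1))
      ((hSP _ (inv_pos.2 hy)).trans (ENNReal.ofReal_le_ofReal ?_))
    rwa [inv_inv, add_comm ((7 / 5 : ℝ) ^ n)⁻¹]
  refine (measure_mono hsub).trans ((measure_iUnion_le _).trans
    ((ENNReal.tsum_le_tsum hb).trans_eq ?_))
  -- Two shells for each `n` and ratio `3/4` give the factor `2 · 4 = 8`.
  have hs := (hasSum_geometric_of_lt_one (r := (3 / 4 : ℝ)) (by norm_num)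
    (by norm_num)).mul_left (2 * Real.exp (q + l ^ 2 / 2 - 3 / 2 * (l * a)))
  rw [← ENNReal.ofReal_tsum_of_nonneg (fun n => by positivity) hs.summable, hs.tsum_eq]
  congr 1
  ring

/-! ### Comparison of constants with the quantile function. -/

/-- The value `8/7` turns the chaining entropy `(7/4) p log 3` into at most `2p`, hence at most
`entropyConst p`. -/
theorem log_three_le : Real.log 3 ≤ 8 / 7 := by
  rw [Real.log_le_iff_le_exp (by norm_num)]
  have h1 := Real.exp_one_gt_d9
  have h2 := Real.add_one_le_exp (1 / 7 : ℝ)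
  have h3 : Real.exp (8 / 7) = Real.exp 1 * Real.exp (1 / 7) := by
    rw [← Real.exp_add]; norm_num
  rw [h3]
  nlinarith

theorem two_mul_le_entropyConst {p : ℕ} : 2 * (p : ℝ) ≤ entropyConst p := by
  unfold entropyConst
  have : (0 : ℝ) ≤ p := p.cast_nonneg
  split_ifs <;> nlinarith

/-- The quantile `zQ` dominates the level needed for the penalized tail bound. -/
theorem exists_level_lt_zQ {p : ℕ} (hp : 0 < p) {G x : ℝ} (hG : 3 ≤ G) (hx : 0 ≤ x) :
    ∃ a l : ℝ, 0 < a ∧ 0 < l ∧ l ≤ G ∧ 35 / 9 ≤ l * a ∧ a ^ 2 < zQ G x (entropyConst p) ∧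
      8 * Real.exp (7 / 4 * (p * Real.log 3) + l ^ 2 / 2 - 3 / 2 * (l * a)) ≤ Real.exp (-x) := by
  have hp1 : (1 : ℝ) ≤ p := by exact_mod_cast hp
  set Q := entropyConst p with hQdef
  have hQ : 2 * (p : ℝ) ≤ Q := two_mul_le_entropyConst
  set s := Real.sqrt (x + Q) with hs
  have hs2 : s ^ 2 = x + Q := Real.sq_sqrt (by linarith)
  have hs0 : 0 ≤ s := Real.sqrt_nonneg _
  have hs1 : (7 / 5 : ℝ) ≤ s := by nlinarith
  have hent : 7 / 4 * (p * Real.log 3) ≤ 2 * p := by nlinarith [log_three_le]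
  have h8 : ∀ y : ℝ, y + 21 / 10 ≤ -x → 8 * Real.exp y ≤ Real.exp (-x) := by
    intro y hy
    have h8e : (8 : ℝ) ≤ Real.exp (21 / 10) := by
      rw [← Real.log_le_iff_le_exp (by norm_num)]
      have : Real.log 8 = 3 * Real.log 2 := by
        rw [show (8 : ℝ) = 2 ^ 3 by norm_num, Real.log_pow]; norm_num
      rw [this]
      linarith [Real.log_two_lt_d9]
    calc 8 * Real.exp y ≤ Real.exp (21 / 10) * Real.exp y := by gcongr
      _ = Real.exp (y + 21 / 10) := by rw [← Real.exp_add, add_comm]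
      _ ≤ _ := Real.exp_le_exp.2 hy
  unfold zQ
  split_ifs with hc
  -- For `a = l` the exponent is the entropy minus `l²`. The shift `3/4` stays strictly below the 1
  -- in `zQ`, while `(3/2) s + 9/16` exceeds the `21/10` that absorbs the factor 8.
  · refine ⟨s + 3 / 4, s + 3 / 4, by linarith, by linarith, by linarith, by nlinarith,
      by nlinarith, h8 _ ?_⟩
    nlinarith
  · have hG0 : 0 < G := by linarith
    have hinv : 0 < G⁻¹ := inv_pos.2 hG0
    have hmul : G * (2 * G⁻¹ * (x + Q) + G) = 2 * (x + Q) + G ^ 2 := by field_simp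
    -- Here `l` is capped at `G`, so that `l a = 2(x + Q) + G²`; the summand 1 in `zQ` gives the
    -- strict inequality.
    refine ⟨2 * G⁻¹ * (x + Q) + G, G, ?_, hG0, le_rfl, ?_, by linarith, h8 _ ?_⟩
    · have : 0 ≤ 2 * G⁻¹ * (x + Q) := mul_nonneg (by positivity) (by linarith)
      linarith
    · rw [hmul]; nlinarith
    · rw [hmul]; nlinarith

/-! ### From gradients to increments. -/

/-- The exponential moment of the increment over `[0, 1]` of a random differentiable function is
controlled by the exponential moments of its derivative. -/
theorem lintegral_exp_sub_le_of_hasDerivAt {Ω : Type*} [MeasurableSpace Ω] {P : Measure Ω}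
    [SFinite P] {f f' : ℝ → Ω → ℝ}
    (hder : ∀ ω, ∀ t ∈ Set.Icc (0 : ℝ) 1, HasDerivAt (fun s => f s ω) (f' t ω) t)
    (hm : ∀ t ∈ Set.Icc (0 : ℝ) 1, Measurable (f t)) {M : ENNReal} (hM : M ≠ ⊤)
    (hpos : ∀ t ∈ Set.Icc (0 : ℝ) 1, ∫⁻ ω, ENNReal.ofReal (Real.exp (f' t ω)) ∂P ≤ M)
    (hneg : ∀ t ∈ Set.Icc (0 : ℝ) 1, ∫⁻ ω, ENNReal.ofReal (Real.exp (-f' t ω)) ∂P ≤ M) :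
    ∫⁻ ω, ENNReal.ofReal (Real.exp (f 1 ω - f 0 ω)) ∂P ≤ M := by
  set τ : Measure ℝ := volume.restrict (Set.Ioo 0 1) with hτ
  have hτp : IsProbabilityMeasure τ := ⟨by simp [hτ]⟩
  have hτae : ∀ᵐ t ∂τ, t ∈ Set.Ioo (0 : ℝ) 1 := ae_restrict_mem measurableSet_Ioo
  -- Clamping time to `[0, 1]` gives a field continuous on all of `ℝ`, hence jointly measurable; its
  -- difference quotients then make `f'` jointly measurable.
  set F : ℝ → Ω → ℝ := fun t ω => f (Set.projIcc (0 : ℝ) 1 zero_le_one t) ω with hF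
  have hFf : ∀ t ∈ Set.Icc (0 : ℝ) 1, ∀ ω, F t ω = f t ω := fun t ht ω => by
    simp only [hF, Set.projIcc_of_mem zero_le_one ht]
  have hFc : ∀ ω, Continuous fun t => F t ω := by
    intro ω
    have h1 : ContinuousOn (fun s => f s ω) (Set.Icc 0 1) :=
      fun t ht => (hder ω t ht).continuousAt.continuousWithinAt
    exact h1.comp_continuous (continuous_subtype_val.comp continuous_projIcc)
      fun t => (Set.projIcc (0 : ℝ) 1 zero_le_one t).2
  have hFm : ∀ t, Measurable (F t) := fun t => hm _ (Set.projIcc (0 : ℝ) 1 zero_le_one t).2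
  have hFu : Measurable (Function.uncurry F) :=
    measurable_uncurry_of_continuous_of_measurable hFc hFm
  have hFder : ∀ ω, ∀ t ∈ Set.Ioo (0 : ℝ) 1, HasDerivAt (fun s => F s ω) (f' t ω) t := by
    intro ω t ht
    refine (hder ω t (Set.Ioo_subset_Icc_self ht)).congr_of_eventuallyEq ?_
    filter_upwards [isOpen_Ioo.mem_nhds ht] with s hs
    exact hFf s (Set.Ioo_subset_Icc_self hs) ω
  have hprod : ∀ᵐ q ∂(τ.prod P), q.1 ∈ Set.Ioo (0 : ℝ) 1 :=
    Measure.quasiMeasurePreserving_fst.ae hτae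
  have hmeas : AEMeasurable (Function.uncurry f') (τ.prod P) := by
    refine aemeasurable_of_tendsto_metrizable_ae atTop
      (f := fun (n : ℕ) (q : ℝ × Ω) =>
        ((1 / ((n : ℝ) + 1)))⁻¹ • (F (q.1 + 1 / ((n : ℝ) + 1)) q.2 - F q.1 q.2)) ?_ ?_
    · intro n
      have h1 : Measurable fun q : ℝ × Ω => F (q.1 + 1 / ((n : ℝ) + 1)) q.2 :=
        hFu.comp ((measurable_fst.add_const _).prodMk measurable_snd)
      exact ((h1.sub hFu).const_mul _).aemeasurable
    · filter_upwards [hprod] with q hq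
      have h1 := (hFder q.2 q.1 hq).tendsto_slope_zero
      have h2 : Tendsto (fun n : ℕ => 1 / ((n : ℝ) + 1)) atTop (𝓝[≠] 0) := by
        refine tendsto_nhdsWithin_iff.2 ⟨tendsto_one_div_add_atTop_nhds_zero_nat, ?_⟩
        refine Eventually.of_forall fun n => ?_
        simp only [Set.mem_compl_iff, Set.mem_singleton_iff]
        positivity
      exact h1.comp h2
  have hbound : ∀ g : ℝ → Ω → ℝ, AEMeasurable (Function.uncurry g) (τ.prod P) →
      (∀ t ∈ Set.Icc (0 : ℝ) 1, ∫⁻ ω, ENNReal.ofReal (Real.exp (g t ω)) ∂P ≤ M) →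
      ∫⁻ q, ENNReal.ofReal (Real.exp (Function.uncurry g q)) ∂(τ.prod P) ≤ M := by
    intro g hg h
    rw [lintegral_prod _ hg.exp.ennreal_ofReal]
    calc ∫⁻ t, ∫⁻ ω, ENNReal.ofReal (Real.exp (Function.uncurry g (t, ω))) ∂P ∂τ
        ≤ ∫⁻ _, M ∂τ := lintegral_mono_ae (hτae.mono fun t ht => h t (Set.Ioo_subset_Icc_self ht))
      _ = M := by simp
  have hint : ∀ g : ℝ → Ω → ℝ, AEMeasurable (Function.uncurry g) (τ.prod P) →
      (∀ t ∈ Set.Icc (0 : ℝ) 1, ∫⁻ ω, ENNReal.ofReal (Real.exp (g t ω)) ∂P ≤ M) →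
      Integrable (fun q => Real.exp (Function.uncurry g q)) (τ.prod P) := fun g hg h =>
    ⟨hg.exp.aestronglyMeasurable, (hasFiniteIntegral_iff_ofReal
      (ae_of_all _ fun _ => (Real.exp_pos _).le)).2 ((hbound g hg h).trans_lt hM.lt_top)⟩
  -- The derivative is not assumed continuous, so the fundamental theorem of calculus needs
  -- integrability. It follows from `|y| ≤ exp y + exp (-y)`, which is why both signs are assumed.
  have hf'int : Integrable (Function.uncurry f') (τ.prod P) := by
    refine Integrable.mono' ((hint f' hmeas hpos).add (hint (fun t ω => -f' t ω) hmeas.neg hneg))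
      hmeas.aestronglyMeasurable (ae_of_all _ fun q => ?_)
    rw [Real.norm_eq_abs]
    have h1 := Real.add_one_le_exp (f' q.1 q.2)
    have h2 := Real.add_one_le_exp (-f' q.1 q.2)
    have h3 := Real.exp_pos (f' q.1 q.2)
    have h4 := Real.exp_pos (-f' q.1 q.2)
    simp only [Function.uncurry, Pi.add_apply]
    rcases abs_cases (f' q.1 q.2) with h | h <;> linarith
  have hpt : ∀ᵐ ω ∂P, ENNReal.ofReal (Real.exp (f 1 ω - f 0 ω)) ≤
      ∫⁻ t, ENNReal.ofReal (Real.exp (f' t ω)) ∂τ := by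
    filter_upwards [hf'int.prod_left_ae] with ω hω
    have hω' : Integrable (fun t => f' t ω) τ := hω
    have hI : IntervalIntegrable (fun t => f' t ω) volume 0 1 := by
      rw [intervalIntegrable_iff_integrableOn_Ioo_of_le zero_le_one]
      exact hω'
    have h1 := intervalIntegral.integral_eq_sub_of_hasDerivAt (f := fun s => f s ω)
      (fun t ht => hder ω t (by rwa [Set.uIcc_of_le zero_le_one] at ht)) hI
    rw [← h1, intervalIntegral.integral_of_le zero_le_one, integral_Ioc_eq_integral_Ioo]
    exact ofReal_exp_integral_le_lintegral hω'
  refine (lintegral_mono_ae hpt).trans ?_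
  refine le_trans (le_of_eq ?_) (hbound f' hmeas hpos)
  rw [lintegral_prod_symm _ hmeas.exp.ennreal_ofReal]
  rfl

/-- A random field with sub-Gaussian gradients on a convex set has sub-Gaussian increments. -/
theorem subgaussianIncrements_of_hasGradientAt {E : Type*} [NormedAddCommGroup E]
    [InnerProductSpace ℝ E] [CompleteSpace E] {Ω : Type*} [MeasurableSpace Ω] {P : Measure Ω}
    [IsProbabilityMeasure P] {B : Set E} (hB : Convex ℝ B) {A : E →L[ℝ] E}
    (hA : Function.Injective A) {g : ℝ} {W : E → Ω → ℝ} {G : E → Ω → E}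
    (hG : ∀ ω, ∀ a ∈ B, HasGradientAt (fun x => W x ω) (G a ω) a)
    (hWm : ∀ a ∈ B, Measurable (W a))
    (hexp : ∀ a ∈ B, ∀ γ : E, γ ≠ 0 → ∀ t : ℝ, |t| ≤ g →
      ∫⁻ ω, ENNReal.ofReal (Real.exp (t * (⟪γ, G a ω⟫ / ‖A γ‖))) ∂P ≤
        ENNReal.ofReal (Real.exp (t ^ 2 / 2))) :
    SubgaussianIncrements P B A g W := by
  intro a ha b hb t ht htg
  by_cases hab : a - b = 0
  · rw [sub_eq_zero.1 hab]
    simp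
  have hAab : 0 < ‖A (a - b)‖ := norm_pos_iff.2 fun h => hab (hA (h.trans (map_zero A).symm))
  have hmem : ∀ s ∈ Set.Icc (0 : ℝ) 1, b + s • (a - b) ∈ B := fun s hs =>
    hB.add_smul_sub_mem hb ha hs
  have habs : |t * ‖A (a - b)‖| ≤ g := by rwa [abs_of_pos (by positivity)]
  have key := lintegral_exp_sub_le_of_hasDerivAt (P := P)
    (f := fun s ω => t * W (b + s • (a - b)) ω)
    (f' := fun s ω => t * ⟪a - b, G (b + s • (a - b)) ω⟫)
    (M := ENNReal.ofReal (Real.exp ((t * ‖A (a - b)‖) ^ 2 / 2))) ?_ ?_ ENNReal.ofReal_ne_top ?_ ?_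
  · simpa [mul_sub] using key
  · intro ω s hs
    have h1 := (hG ω _ (hmem s hs)).hasFDerivAt
    have h2 : HasDerivAt (fun s : ℝ => b + s • (a - b)) (a - b) s := by
      simpa using ((hasDerivAt_id s).smul_const (a - b)).const_add b
    have h3 := (h1.comp_hasDerivAt s h2).const_mul t
    simpa [real_inner_comm] using h3
  · intro s hs
    exact (hWm _ (hmem s hs)).const_mul t
  · intro s hs
    refine le_trans (le_of_eq ?_) (hexp _ (hmem s hs) _ hab _ habs)
    congr 1 with ω
    field_simp
  · intro s hs
    refine le_trans (le_of_eq ?_) ((hexp _ (hmem s hs) _ hab (-(t * ‖A (a - b)‖))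
      (by rwa [abs_neg])).trans_eq (by rw [neg_sq]))
    congr 1 with ω
    field_simp

/-! ### Matrix square roots and the Gaussian form. -/

section Matrices

variable {p : ℕ}

theorem app_mul (A B : Matrix (Fin p) (Fin p) ℝ) (h : Param p) :
    app (A * B) h = app A (app B h) := by
  simp [app]

theorem inner_app_right {A : Matrix (Fin p) (Fin p) ℝ} (hA : A.IsHermitian) (x y : Param p) :
    ⟪x, app A y⟫ = ⟪app A x, y⟫ := by
  have h : Matrix.toEuclideanCLM (𝕜 := ℝ) A =
      ContinuousLinearMap.adjoint (Matrix.toEuclideanCLM (𝕜 := ℝ) A) := by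
    rw [← ContinuousLinearMap.star_eq_adjoint, ← map_star, Matrix.star_eq_conjTranspose, hA.eq]
  unfold app
  conv_lhs => rw [h]
  exact ContinuousLinearMap.adjoint_inner_right _ _ _

theorem norm_app_sq {A : Matrix (Fin p) (Fin p) ℝ} (hA : A.IsHermitian) (h : Param p) :
    ‖app A h‖ ^ 2 = ⟪h, app (A * A) h⟫ := by
  rw [app_mul, inner_app_right hA, real_inner_self_eq_norm_sq]

theorem app_inv_app {A : Matrix (Fin p) (Fin p) ℝ} (hA : IsUnit A) (h : Param p) :
    app A⁻¹ (app A h) = h := by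
  rw [← app_mul, Matrix.nonsing_inv_mul A ((Matrix.isUnit_iff_isUnit_det A).1 hA)]
  simp [app]

theorem app_injective {A : Matrix (Fin p) (Fin p) ℝ} (hA : IsUnit A) :
    Function.Injective (Matrix.toEuclideanCLM (𝕜 := ℝ) A) :=
  Function.LeftInverse.injective (g := app A⁻¹) (app_inv_app hA)

variable {D V : Matrix (Fin p) (Fin p) ℝ} {δ w : ℝ}

theorem isHermitian_Deps : (Deps D V δ w).IsHermitian :=
  (Matrix.nonneg_iff_posSemidef.1 (CFC.sqrt_nonneg (DepsSq D V δ w))).1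

theorem Deps_mul_Deps (h : (DepsSq D V δ w).PosSemidef) :
    Deps D V δ w * Deps D V δ w = DepsSq D V δ w :=
  CFC.sqrt_mul_sqrt_self _ h.nonneg

theorem norm_app_Deps_sq (hD : D.IsHermitian) (hV : V.IsHermitian)
    (h : (DepsSq D V δ w).PosSemidef) (x : Param p) :
    ‖app (Deps D V δ w) x‖ ^ 2 = (1 - δ) * ‖app D x‖ ^ 2 - w * ‖app V x‖ ^ 2 := by
  rw [norm_app_sq isHermitian_Deps, Deps_mul_Deps h, norm_app_sq hD, norm_app_sq hV]
  simp [app, DepsSq, inner_sub_right, inner_smul_right]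

theorem posDef_mul_self {A : Matrix (Fin p) (Fin p) ℝ} (hA : A.PosDef) : (A * A).PosDef := by
  have h := Matrix.PosDef.conjTranspose_mul_self A (Matrix.mulVec_injective_iff_isUnit.2 hA.isUnit)
  rwa [hA.1.eq] at h

theorem posDef_DepsSq_neg (hD : D.PosDef) (hV : V.PosDef) (hδ : 0 ≤ δ) (hw : 0 < w) :
    (DepsSq D V (-δ) (-w)).PosDef := by
  have e : DepsSq D V (-δ) (-w) = (1 + δ) • (D * D) + w • (V * V) := by
    simp [DepsSq]
  rw [e]
  exact ((posDef_mul_self hD).smul (by linarith : (0 : ℝ) < 1 + δ)).add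
    ((posDef_mul_self hV).smul hw)

theorem isUnit_Deps (h : (DepsSq D V δ w).PosDef) : IsUnit (Deps D V δ w) := by
  have h1 := h.isUnit
  rw [← Deps_mul_Deps h.posSemidef] at h1
  exact isUnit_of_mul_isUnit_left h1

/-- The quadratic process is the log-likelihood ratio of a linear Gaussian model. -/
theorem quadProc_eq {Ω : Type*} {L : Param p → Ω → ℝ} (h : (DepsSq D V δ w).PosDef)
    (θ θs : Param p) (ω : Ω) :
    quadProc L D V δ w θ θs ω = ⟪xi L D V δ w θs ω, app (Deps D V δ w) (θ - θs)⟫ -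
      ‖app (Deps D V δ w) (θ - θs)‖ ^ 2 / 2 := by
  unfold quadProc xi
  rw [← inner_app_right isHermitian_Deps.inv, app_inv_app (isUnit_Deps h), real_inner_comm]

end Matrices

/-! ### The local set, the mean and the linearization remainder. -/

section Field

variable {p : ℕ} {Ω : Type*} [MeasurableSpace Ω] {P : Measure Ω}
  {Θ : Set (Param p)} {θs : Param p} {L : Param p → Ω → ℝ} {V D : Matrix (Fin p) (Fin p) ℝ}
  {ν g r rs δ w : ℝ} {ρ δr : ℝ → ℝ}

theorem localSet_mem_nhds (hθs : θs ∈ interior Θ) (hr : 0 < r) : localSet Θ θs V r ∈ 𝓝 θs := by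
  have hc : Continuous fun θ => ‖app V (θ - θs)‖ := by unfold app; fun_prop
  have h2 : ∀ᶠ θ in 𝓝 θs, ‖app V (θ - θs)‖ < r :=
    hc.continuousAt.eventually (gt_mem_nhds (by simpa [app] using hr))
  filter_upwards [mem_interior_iff_mem_nhds.1 hθs, h2] with θ h3 h4 using ⟨h3, h4.le⟩

theorem isBounded_localSet (hV : IsUnit V) : Bornology.IsBounded (localSet Θ θs V r) := by
  rw [isBounded_iff_forall_norm_le]
  refine ⟨‖Matrix.toEuclideanCLM (𝕜 := ℝ) V⁻¹‖ * r + ‖θs‖, fun θ hθ => ?_⟩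
  have h1 : ‖θ - θs‖ ≤ ‖Matrix.toEuclideanCLM (𝕜 := ℝ) V⁻¹‖ * r := by
    conv_lhs => rw [← app_inv_app hV (θ - θs)]
    exact (ContinuousLinearMap.le_opNorm _ _).trans
      (mul_le_mul_of_nonneg_left hθ.2 (norm_nonneg _))
  calc ‖θ‖ = ‖(θ - θs) + θs‖ := by rw [sub_add_cancel]
    _ ≤ _ := (norm_add_le _ _).trans (by linarith)

theorem integral_llr (hint : ∀ θ ∈ Θ, Integrable (L θ) P) {θ : Param p} (hθ : θ ∈ Θ)
    (hθs : θs ∈ Θ) : ∫ ω, llr L θ θs ω ∂P = meanL P L θ - meanL P L θs :=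
  integral_sub (hint θ hθ) (hint θs hθs)

theorem norm_app_sub_sq_pos (hD : IsUnit D) {θ : Param p} (hθ : θ ≠ θs) :
    0 < ‖app D (θ - θs)‖ ^ 2 := by
  have : app D (θ - θs) ≠ 0 := fun h => sub_ne_zero.2 hθ
    (app_injective hD (h.trans (map_zero (Matrix.toEuclideanCLM (𝕜 := ℝ) D)).symm))
  positivity

/-- The quadratic two-sided bound on the mean log-likelihood ratio. -/
theorem CondL0.bounds (hL0 : CondL0 P Θ θs L V D rs δr) (hD : IsUnit D) (hr : 0 < r)
    (hrs : r ≤ rs) (hδ : δr r ≤ δ) {θ : Param p} (hθ : θ ∈ localSet Θ θs V r) :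
    (1 - δ) * ‖app D (θ - θs)‖ ^ 2 ≤ -2 * ∫ ω, llr L θ θs ω ∂P ∧
      -2 * ∫ ω, llr L θ θs ω ∂P ≤ (1 + δ) * ‖app D (θ - θs)‖ ^ 2 := by
  by_cases h : θ = θs
  · subst h
    simp [llr, app]
  · have hpos := norm_app_sub_sq_pos hD h
    have h1 := abs_le.1 (((hL0 r hr hrs).2 θ hθ h).trans hδ)
    constructor
    · rw [← le_div_iff₀ hpos]; linarith
    · rw [← div_le_iff₀ hpos]; linarith

/-- In positive dimension the local set contains a point other than `θs`, where an absolute value is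
bounded by `δr r`. This gives positive definiteness for the index `-ε`. -/
theorem CondL0.nonneg (hp : 0 < p) (hθs : θs ∈ interior Θ)
    (hL0 : CondL0 P Θ θs L V D rs δr) (hr : 0 < r) (hrs : r ≤ rs) : 0 ≤ δr r := by
  have : Nonempty (Fin p) := ⟨⟨0, hp⟩⟩
  have h1 : ∀ᶠ θ in 𝓝[≠] θs, θ ∈ localSet Θ θs V r :=
    nhdsWithin_le_nhds (localSet_mem_nhds hθs hr)
  obtain ⟨θ, hθ, hne⟩ := (h1.and self_mem_nhdsWithin).exists
  exact (abs_nonneg _).trans ((hL0 r hr hrs).2 θ hθ hne)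

/-- Identifiability makes the mean differ from its value at `θs` by `O(‖θ - θs‖²)`, so
differentiability of the mean at `θs` need not be assumed. -/
theorem hasFDerivAt_meanL (hθs : θs ∈ interior Θ) (hint : ∀ θ ∈ Θ, Integrable (L θ) P)
    (hL0 : CondL0 P Θ θs L V D rs δr) (hD : IsUnit D) (hr : 0 < r) (hrs : r ≤ rs) :
    HasFDerivAt (meanL P L) (0 : Param p →L[ℝ] ℝ) θs := by
  have h1 : (fun θ => meanL P L θ - meanL P L θs) =O[𝓝 θs] fun θ => ‖θ - θs‖ ^ 2 := by
    refine Asymptotics.IsBigO.of_bound (‖Matrix.toEuclideanCLM (𝕜 := ℝ) D‖ ^ 2) ?_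
    filter_upwards [localSet_mem_nhds (V := V) hθs hr] with θ hθ
    obtain ⟨h2, h3⟩ := hL0.bounds hD hr hrs (hL0 r hr hrs).1 hθ
    rw [integral_llr hint hθ.1 (interior_subset hθs)] at h2 h3
    have h4 : ‖app D (θ - θs)‖ ^ 2 ≤ ‖Matrix.toEuclideanCLM (𝕜 := ℝ) D‖ ^ 2 * ‖θ - θs‖ ^ 2 := by
      rw [← mul_pow]
      exact pow_le_pow_left₀ (norm_nonneg _) (ContinuousLinearMap.le_opNorm _ _) 2
    have h5 := sq_nonneg ‖app D (θ - θs)‖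
    rw [Real.norm_eq_abs, norm_pow, norm_norm, abs_le]
    constructor <;> linarith
  simpa using (h1.hasFDerivAt one_lt_two).add_const (meanL P L θs)

theorem gradL_eq_gradZeta (hθs : θs ∈ interior Θ) (hint : ∀ θ ∈ Θ, Integrable (L θ) P)
    (hL0 : CondL0 P Θ θs L V D rs δr) (hD : IsUnit D) (hr : 0 < r) (hrs : r ≤ rs) {ω : Ω}
    (hdiff : DifferentiableAt ℝ (fun θ => zeta P L θ ω) θs) :
    gradL L θs ω = gradZeta P L θs ω := by
  have h1 := (hdiff.hasGradientAt.hasFDerivAt.add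
    (hasFDerivAt_meanL hθs hint hL0 hD hr hrs))
  rw [add_zero] at h1
  have e : (fun θ => zeta P L θ ω) + meanL P L = fun θ => L θ ω := by
    ext θ
    simp [zeta]
  rw [e] at h1
  exact (hasGradientAt_iff_hasFDerivAt.2 h1).gradient

/-- The remainder of the linearization of the stochastic component at `θs`. -/
noncomputable def remainder (P : Measure Ω) (L : Param p → Ω → ℝ) (θs θ : Param p) (ω : Ω) : ℝ :=
  zeta P L θ ω - zeta P L θs ω - ⟪θ - θs, gradZeta P L θs ω⟫

theorem hasGradientAt_smul_remainder {θ : Param p} {ω : Ω} (c : ℝ)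
    (hdiff : DifferentiableAt ℝ (fun θ => zeta P L θ ω) θ) :
    HasGradientAt (fun θ => c * remainder P L θs θ ω)
      (c • (gradZeta P L θ ω - gradZeta P L θs ω)) θ := by
  rw [hasGradientAt_iff_hasFDerivAt]
  have h1 : HasFDerivAt (fun θ => zeta P L θ ω)
    (InnerProductSpace.toDual ℝ (Param p) (gradZeta P L θ ω)) θ := hdiff.hasGradientAt.hasFDerivAt
  have h2 : HasFDerivAt (fun θ : Param p => ⟪θ - θs, gradZeta P L θs ω⟫)
      (InnerProductSpace.toDual ℝ (Param p) (gradZeta P L θs ω)) θ := by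
    have h3 := (InnerProductSpace.toDual ℝ (Param p) (gradZeta P L θs ω)).hasFDerivAt
      (x := θ - θs) |>.comp θ ((hasFDerivAt_id θ).sub_const θs)
    simpa [Function.comp_def, real_inner_comm, ContinuousLinearMap.comp_id] using h3
  have h4 := ((h1.sub_const (zeta P L θs ω)).sub h2).const_mul c
  simpa [remainder] using h4

theorem measurable_zeta (hmeas : ∀ θ ∈ Θ, Measurable (L θ)) {θ : Param p} (hθ : θ ∈ Θ) :
    Measurable (zeta P L θ) :=
  (hmeas θ hθ).sub_const _

/-- The gradient term is a pointwise limit of difference quotients along the segment from `θs` to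
`θ`, which convexity keeps inside the region where `L` is measurable. -/
theorem measurable_remainder (hmeas : ∀ θ ∈ Θ, Measurable (L θ))
    (hconv : Convex ℝ (localSet Θ θs V r)) (hs : θs ∈ localSet Θ θs V r)
    (hdiff : ∀ ω, DifferentiableAt ℝ (fun θ => zeta P L θ ω) θs) {θ : Param p}
    (hθ : θ ∈ localSet Θ θs V r) : Measurable (remainder P L θs θ) := by
  have h1 : Measurable fun ω => ⟪θ - θs, gradZeta P L θs ω⟫ := by
    refine measurable_of_tendsto_metrizable (f := fun (n : ℕ) ω => (1 / ((n : ℝ) + 1))⁻¹ *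
      (zeta P L (θs + (1 / ((n : ℝ) + 1)) • (θ - θs)) ω - zeta P L θs ω)) (fun n => ?_) ?_
    · have h2 : θs + (1 / ((n : ℝ) + 1)) • (θ - θs) ∈ localSet Θ θs V r := by
        refine hconv.add_smul_sub_mem hs hθ ⟨by positivity, ?_⟩
        rw [div_le_one (by positivity)]
        linarith [n.cast_nonneg (α := ℝ)]
      exact ((measurable_zeta hmeas h2.1).sub (measurable_zeta hmeas hs.1)).const_mul _
    · rw [tendsto_pi_nhds]
      intro ω
      have h3 := (hdiff ω).hasGradientAt.hasFDerivAt.hasLineDerivAt (θ - θs)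
      have h4 := h3.tendsto_slope_zero
      have h5 : Tendsto (fun n : ℕ => 1 / ((n : ℝ) + 1)) atTop (𝓝[≠] 0) := by
        refine tendsto_nhdsWithin_iff.2 ⟨tendsto_one_div_add_atTop_nhds_zero_nat, ?_⟩
        refine Eventually.of_forall fun n => ?_
        simp only [Set.mem_compl_iff, Set.mem_singleton_iff]
        positivity
      have h6 := h4.comp h5
      rw [real_inner_comm]
      exact h6
  exact ((measurable_zeta hmeas hθ.1).sub (measurable_zeta hmeas hs.1)).sub h1

/-- Condition `(ED₁)` makes the normalized remainder a field with sub-Gaussian increments. -/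
theorem CondED1.subgaussianIncrements [IsProbabilityMeasure P]
    (hED1 : CondED1 P Θ θs L V ν g rs ρ) (hmeas : ∀ θ ∈ Θ, Measurable (L θ)) (hV : IsUnit V)
    (hν : 0 < ν) (hr : 0 < r) (hrs : r ≤ rs) (hconv : Convex ℝ (localSet Θ θs V r))
    (hs : θs ∈ localSet Θ θs V r)
    (hdiff : ∀ ω, ∀ θ ∈ localSet Θ θs V r, DifferentiableAt ℝ (fun θ' => zeta P L θ' ω) θ)
    {σ : ℝ} (hσ : |σ| = 1) :
    SubgaussianIncrements P (localSet Θ θs V r) (Matrix.toEuclideanCLM (𝕜 := ℝ) V) (g * ν)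
      fun θ ω => σ / (ν * ρ r) * remainder P L θs θ ω := by
  obtain ⟨hρ, -, hexp⟩ := hED1 r hr hrs
  refine subgaussianIncrements_of_hasGradientAt hconv (app_injective hV)
    (fun ω θ hθ => hasGradientAt_smul_remainder _ (hdiff ω θ hθ))
    (fun θ hθ => (measurable_remainder hmeas hconv hs (fun ω => hdiff ω θs hs) hθ).const_mul _)
    fun θ hθ γ hγ t ht => ?_
  -- Dividing the field by `ν` normalizes the variance factor to 1 and enlarges the range of
  -- exponents from `g` to `g * ν`.
  have ht' : |t * σ / ν| ≤ g := by
    rw [abs_div, abs_mul, hσ, mul_one, abs_of_pos hν, div_le_iff₀ hν]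
    exact ht
  obtain ⟨hi, hb⟩ := hexp θ hθ γ hγ (t * σ / ν) ht'
  have e : ∀ ω, t * (⟪γ, (σ / (ν * ρ r)) • (gradZeta P L θ ω - gradZeta P L θs ω)⟫ /
      ‖Matrix.toEuclideanCLM (𝕜 := ℝ) V γ‖) =
      t * σ / ν * (⟪γ, gradZeta P L θ ω - gradZeta P L θs ω⟫ / (ρ r * ‖app V γ‖)) := by
    intro ω
    have h0 : ‖Matrix.toEuclideanCLM (𝕜 := ℝ) V γ‖ = ‖app V γ‖ := rfl
    rw [real_inner_smul_right, h0]
    field_simp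
  simp only [e]
  rw [← ofReal_integral_eq_lintegral_ofReal hi (ae_of_all _ fun _ => (Real.exp_pos _).le)]
  refine ENNReal.ofReal_le_ofReal ?_
  have h1 := exp_cgf hi
  rw [mgf] at h1
  rw [← h1]
  refine Real.exp_le_exp.2 (hb.trans_eq ?_)
  have h2 : σ ^ 2 = 1 := by rw [← sq_abs, hσ, one_pow]
  field_simp
  rw [h2, mul_one]

end Field

/-- A random field with sub-Gaussian increments on a bounded convex set is almost surely bounded
above. -/
theorem ae_exists_forall_le {E : Type*} [NormedAddCommGroup E] [NormedSpace ℝ E]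
    [FiniteDimensional ℝ E] [MeasurableSpace E] [BorelSpace E] {Ω : Type*} [MeasurableSpace Ω]
    {P : Measure Ω} [SFinite P] {B : Set E} (hBb : Bornology.IsBounded B) (hB : Convex ℝ B) {o : E}
    (ho : o ∈ interior B) {A : E →L[ℝ] E} {g R : ℝ} {W : E → Ω → ℝ}
    (hinc : SubgaussianIncrements P B A g W)
    (hWc : ∀ ω, ContinuousOn (fun a => W a ω) B) (hWm : ∀ a ∈ B, Measurable (W a))
    (hWo : ∀ ω, W o ω = 0) (hR : 0 < R) (hBR : ∀ a ∈ B, ‖A (a - o)‖ ≤ R) (hg : 0 < g) :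
    ∀ᵐ ω ∂P, ∃ M : ℝ, ∀ a ∈ B, W a ω ≤ M := by
  rw [ae_iff]
  have hlim : Tendsto (fun M : ℝ => ENNReal.ofReal (Real.exp (-(g / (2 * R) * M) + g ^ 2 / 2 +
      7 / 4 * (Module.finrank ℝ E * Real.log 3)))) atTop (𝓝 0) := by
    rw [← ENNReal.ofReal_zero]
    refine (ENNReal.continuous_ofReal.tendsto 0).comp (Real.tendsto_exp_atBot.comp ?_)
    refine tendsto_atBot_add_const_right _ _ (tendsto_atBot_add_const_right _ _ ?_)
    exact tendsto_neg_atTop_atBot.comp (tendsto_id.const_mul_atTop (by positivity))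
  refine le_antisymm (ge_of_tendsto' hlim fun M => le_trans (measure_mono fun ω hω => ?_)
    (measure_exists_lt_le hBb hB ho hinc hWc hWm hWo hR hBR hg le_rfl M)) zero_le
  simp only [Set.mem_ofPred_eq, not_exists, not_forall, not_le] at hω
  obtain ⟨a, ha, h⟩ := hω M
  exact ⟨a, ha, h⟩

/-! ### The errors as penalized suprema. -/

section Errors

variable {p : ℕ} {Ω : Type*} [MeasurableSpace Ω] {P : Measure Ω}
  {Θ : Set (Param p)} {θs : Param p} {L : Param p → Ω → ℝ} {V D : Matrix (Fin p) (Fin p) ℝ}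
  {ν g r rs δ w : ℝ} {ρ δr : ℝ → ℝ}

/-- The supremum over the local set of `σ` times the remainder, penalized by `(w / 2) ‖V ·‖²`. -/
noncomputable def penalizedSup (P : Measure Ω) (Θ : Set (Param p)) (θs : Param p)
    (L : Param p → Ω → ℝ) (V : Matrix (Fin p) (Fin p) ℝ) (w r σ : ℝ) (ω : Ω) : EReal :=
  ⨆ θ ∈ localSet Θ θs V r,
    ((σ * remainder P L θs θ ω - w / 2 * ‖app V (θ - θs)‖ ^ 2 : ℝ) : EReal)

theorem llr_sub_eq_remainder (hθs : θs ∈ interior Θ) (hint : ∀ θ ∈ Θ, Integrable (L θ) P)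
    {ω : Ω} (hgrad : gradL L θs ω = gradZeta P L θs ω) {θ : Param p}
    (hθ : θ ∈ localSet Θ θs V r) :
    llr L θ θs ω - ∫ ω', llr L θ θs ω' ∂P - ⟪θ - θs, gradL L θs ω⟫ = remainder P L θs θ ω := by
  rw [integral_llr hint hθ.1 (interior_subset hθs), hgrad]
  simp only [llr, remainder, zeta]
  ring

theorem errUpper_eq (hθs : θs ∈ interior Θ) (hint : ∀ θ ∈ Θ, Integrable (L θ) P)
    {ω : Ω} (hgrad : gradL L θs ω = gradZeta P L θs ω) :
    errUpper P Θ θs L V w r ω = penalizedSup P Θ θs L V w r 1 ω :=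
  iSup_congr fun θ => iSup_congr fun hθ => by rw [llr_sub_eq_remainder hθs hint hgrad hθ, one_mul]

theorem errLower_eq (hθs : θs ∈ interior Θ) (hint : ∀ θ ∈ Θ, Integrable (L θ) P)
    {ω : Ω} (hgrad : gradL L θs ω = gradZeta P L θs ω) :
    errLower P Θ θs L V w r ω = penalizedSup P Θ θs L V w r (-1) ω :=
  iSup_congr fun θ => iSup_congr fun hθ => by rw [llr_sub_eq_remainder hθs hint hgrad hθ, neg_one_mul]

theorem penalizedSup_nonneg (hs : θs ∈ localSet Θ θs V r) (σ : ℝ) (ω : Ω) :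
    0 ≤ penalizedSup P Θ θs L V w r σ ω := by
  refine le_trans (le_of_eq ?_) (le_iSup₂_of_le θs hs le_rfl)
  simp [remainder, app]

variable [IsProbabilityMeasure P]

theorem ae_penalizedSup_lt_top (hED1 : CondED1 P Θ θs L V ν g rs ρ)
    (hmeas : ∀ θ ∈ Θ, Measurable (L θ)) (hV : IsUnit V) (hν : 0 < ν) (hg : 0 < g) (hw : 0 ≤ w)
    (hr : 0 < r) (hrs : r ≤ rs) (hconv : Convex ℝ (localSet Θ θs V r)) (hθs : θs ∈ interior Θ)
    (hdiff : ∀ ω, ∀ θ ∈ localSet Θ θs V r, DifferentiableAt ℝ (fun θ' => zeta P L θ' ω) θ)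
    {σ : ℝ} (hσ : |σ| = 1) : ∀ᵐ ω ∂P, penalizedSup P Θ θs L V w r σ ω < ⊤ := by
  have hnhds := localSet_mem_nhds (V := V) hθs hr
  have hs := mem_of_mem_nhds hnhds
  have hρ := (hED1 r hr hrs).1
  have hc : 0 < ν * ρ r := mul_pos hν hρ
  filter_upwards [ae_exists_forall_le (isBounded_localSet hV) hconv (mem_interior_iff_mem_nhds.2 hnhds)
    (hED1.subgaussianIncrements hmeas hV hν hr hrs hconv hs hdiff hσ)
    (fun ω θ hθ => (hasGradientAt_smul_remainder _
      (hdiff ω θ hθ)).continuousAt.continuousWithinAt)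
    (fun θ hθ => (measurable_remainder hmeas hconv hs (fun ω => hdiff ω θs hs) hθ).const_mul _)
    (fun ω => by simp [remainder]) hr (fun θ hθ => hθ.2) (mul_pos hg hν)] with ω ⟨M, hM⟩
  refine lt_of_le_of_lt (iSup₂_le fun θ hθ => EReal.coe_le_coe_iff.2 ?_)
    (EReal.coe_lt_top (ν * ρ r * M))
  have h1 := mul_le_mul_of_nonneg_left (hM θ hθ) hc.le
  have h2 : ν * ρ r * (σ / (ν * ρ r) * remainder P L θs θ ω) = σ * remainder P L θs θ ω := by
    field_simp
  rw [h2] at h1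
  have : 0 ≤ w / 2 * ‖app V (θ - θs)‖ ^ 2 := by positivity
  linarith

/-- The exponential bound for the penalized supremum. -/
theorem measure_zQ_le_penalizedSup_le (hp : 0 < p) (hED1 : CondED1 P Θ θs L V ν g rs ρ)
    (hmeas : ∀ θ ∈ Θ, Measurable (L θ)) (hV : IsUnit V) (hν : 0 < ν)
    (hr : 0 < r) (hrs : r ≤ rs) (hconv : Convex ℝ (localSet Θ θs V r)) (hθs : θs ∈ interior Θ)
    (hdiff : ∀ ω, ∀ θ ∈ localSet Θ θs V r, DifferentiableAt ℝ (fun θ' => zeta P L θ' ω) θ)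
    (hw : 3 * ν * ρ r ≤ w) (hg : 3 ≤ g * ν) {x : ℝ} (hx : 0 ≤ x) {σ : ℝ} (hσ : |σ| = 1) :
    P {ω | (zQ (g * ν) x (entropyConst p) : EReal) ≤
      ((w⁻¹ : ℝ) : EReal) * penalizedSup P Θ θs L V w r σ ω} ≤
        ENNReal.ofReal (Real.exp (-x)) := by
  have hnhds := localSet_mem_nhds (V := V) hθs hr
  have hs := mem_of_mem_nhds hnhds
  have hρ := (hED1 r hr hrs).1
  have hc : 0 < ν * ρ r := mul_pos hν hρ
  have hw0 : 0 < w := by linarith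
  obtain ⟨a, l, ha, hl, hlg, hla, haz, hexp⟩ := exists_level_lt_zQ hp hg hx
  have hbound := measure_exists_quadratic_lt_le (isBounded_localSet hV) hconv
    (mem_interior_iff_mem_nhds.2 hnhds) (app_injective hV)
    (hED1.subgaussianIncrements hmeas hV hν hr hrs hconv hs hdiff hσ)
    (fun ω θ hθ => (hasGradientAt_smul_remainder _
      (hdiff ω θ hθ)).continuousAt.continuousWithinAt)
    (fun θ hθ => (measurable_remainder hmeas hconv hs (fun ω => hdiff ω θs hs) hθ).const_mul _)
    (fun ω => by simp [remainder]) ha hl hlg hla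
  rw [finrank_euclideanSpace_fin] at hbound
  refine (measure_mono fun ω hω => ?_).trans (hbound.trans (ENNReal.ofReal_le_ofReal hexp))
  simp only [Set.mem_ofPred_eq] at hω ⊢
  by_contra hcon
  push Not at hcon
  -- Off the exceptional event the signed remainder is at most `3νρ(a² + ‖V(θ - θs)‖²/2)`. Since
  -- `3νρ ≤ w`, the penalty cancels the quadratic term and leaves `w a²`. The supremum may only
  -- approach this value, hence the strict `a² < zQ`.
  have hle : penalizedSup P Θ θs L V w r σ ω ≤ ((w * a ^ 2 : ℝ) : EReal) := by
    refine iSup₂_le fun θ hθ => EReal.coe_le_coe_iff.2 ?_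
    have h0 : ‖Matrix.toEuclideanCLM (𝕜 := ℝ) V (θ - θs)‖ = ‖app V (θ - θs)‖ := rfl
    have h1 := mul_le_mul_of_nonneg_left (hcon θ hθ) hc.le
    have h2 : ν * ρ r * (σ / (ν * ρ r) * remainder P L θs θ ω) = σ * remainder P L θs θ ω := by
      field_simp
    rw [h2, h0] at h1
    have h3 := mul_le_mul_of_nonneg_right hw
      (show 0 ≤ a ^ 2 + ‖app V (θ - θs)‖ ^ 2 / 2 by positivity)
    linarith
  have h4 : ((w⁻¹ : ℝ) : EReal) * penalizedSup P Θ θs L V w r σ ω ≤ ((a ^ 2 : ℝ) : EReal) := by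
    refine (mul_le_mul_of_nonneg_left hle (EReal.coe_nonneg.2 (inv_pos.2 hw0).le)).trans_eq ?_
    rw [← EReal.coe_mul, inv_mul_cancel_left₀ hw0.ne']
  exact absurd (hω.trans h4) (not_le.2 (EReal.coe_lt_coe_iff.2 haz))

end Errors

end Bracketing

theorem theorem3p1 {p : ℕ} (hp : 0 < p)
    {Ω : Type*} [MeasurableSpace Ω] (P : Measure Ω) [IsProbabilityMeasure P]
    -- the parameter set, the central point and the quasi-log-likelihood process
    (Θ : Set (Bracketing.Param p)) (θs : Bracketing.Param p) (hθs : θs ∈ interior Θ)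
    (L : Bracketing.Param p → Ω → ℝ)
    (hmeas : ∀ θ ∈ Θ, Measurable (L θ)) (hint : ∀ θ ∈ Θ, Integrable (L θ) P)
    -- the matrices of the local geometry and the constants of the conditions
    (V D : Matrix (Fin p) (Fin p) ℝ) (hV : V.PosDef) (hD : D.PosDef)
    (ν g rs : ℝ) (hν : 1 ≤ ν) (hg : 0 < g) (ρ δr : ℝ → ℝ)
    (hED1 : Bracketing.CondED1 P Θ θs L V ν g rs ρ)
    (hL0 : Bracketing.CondL0 P Θ θs L V D rs δr)
    -- the local zone
    (r : ℝ) (hr : 0 < r) (hrs : r ≤ rs)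
    (hconv : Convex ℝ (Bracketing.localSet Θ θs V r))
    (hdiff : ∀ ω, ∀ θ ∈ Bracketing.localSet Θ θs V r,
      DifferentiableAt ℝ (fun θ' => Bracketing.zeta P L θ' ω) θ)
    -- the choice of `ε = (δ, w)`
    (δ w : ℝ) (hw : 3 * ν * ρ r ≤ w) (hδ : δr r ≤ δ)
    (hpos : (Bracketing.DepsSq D V δ w).PosSemidef) :
    -- the bracketing bound
    (∀ ω, ∀ θ ∈ Bracketing.localSet Θ θs V r,
      (Bracketing.quadProc L D V (-δ) (-w) θ θs ω : EReal)
          - Bracketing.errLower P Θ θs L V w r ω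
        ≤ (Bracketing.llr L θ θs ω : EReal) ∧
      (Bracketing.llr L θ θs ω : EReal)
        ≤ (Bracketing.quadProc L D V δ w θ θs ω : EReal)
          + Bracketing.errUpper P Θ θs L V w r ω) ∧
    -- the linear Gaussian structure of the two bracketing processes
    ((Bracketing.DepsSq D V δ w).PosDef → ∀ ω θ,
      Bracketing.quadProc L D V δ w θ θs ω
        = ⟪Bracketing.xi L D V δ w θs ω,
            Bracketing.app (Bracketing.Deps D V δ w) (θ - θs)⟫
          - ‖Bracketing.app (Bracketing.Deps D V δ w) (θ - θs)‖ ^ 2 / 2) ∧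
    ((Bracketing.DepsSq D V (-δ) (-w)).PosDef ∧ ∀ ω θ,
      Bracketing.quadProc L D V (-δ) (-w) θ θs ω
        = ⟪Bracketing.xi L D V (-δ) (-w) θs ω,
            Bracketing.app (Bracketing.Deps D V (-δ) (-w)) (θ - θs)⟫
          - ‖Bracketing.app (Bracketing.Deps D V (-δ) (-w)) (θ - θs)‖ ^ 2 / 2) ∧
    -- the errors are nonnegative, almost surely finite, with the exponential bound
    (∀ ω, 0 ≤ Bracketing.errUpper P Θ θs L V w r ω ∧
      0 ≤ Bracketing.errLower P Θ θs L V w r ω) ∧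
    (∀ᵐ ω ∂P, Bracketing.errUpper P Θ θs L V w r ω < ⊤ ∧
      Bracketing.errLower P Θ θs L V w r ω < ⊤) ∧
    (3 ≤ g * ν → ∀ x : ℝ, 0 ≤ x →
      P {ω | (Bracketing.zQ (g * ν) x (Bracketing.entropyConst p) : EReal)
          ≤ ((w⁻¹ : ℝ) : EReal) * Bracketing.errUpper P Θ θs L V w r ω}
        ≤ ENNReal.ofReal (Real.exp (-x)) ∧
      P {ω | (Bracketing.zQ (g * ν) x (Bracketing.entropyConst p) : EReal)
          ≤ ((w⁻¹ : ℝ) : EReal) * Bracketing.errLower P Θ θs L V w r ω}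
        ≤ ENNReal.ofReal (Real.exp (-x))) := by
  have hw0 : 0 < w := lt_of_lt_of_le
    (mul_pos (by linarith : 0 < 3 * ν) (hED1 r hr hrs).1) hw
  have hν0 : 0 < ν := by linarith
  have hs : θs ∈ Bracketing.localSet Θ θs V r :=
    mem_of_mem_nhds (Bracketing.localSet_mem_nhds hθs hr)
  have hgrad : ∀ ω, Bracketing.gradL L θs ω = Bracketing.gradZeta P L θs ω := fun ω =>
    Bracketing.gradL_eq_gradZeta hθs hint hL0 hD.isUnit hr hrs (hdiff ω θs hs)
  have hδ0 : 0 ≤ δ := (hL0.nonneg hp hθs hr hrs).trans hδ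
  have hposneg := Bracketing.posDef_DepsSq_neg hD hV hδ0 hw0
  refine ⟨fun ω θ hθ => ?_, fun h ω θ => Bracketing.quadProc_eq h θ θs ω,
    ⟨hposneg, fun ω θ => Bracketing.quadProc_eq hposneg θ θs ω⟩, fun ω => ?_, ?_, fun h3 x hx => ?_⟩
  · obtain ⟨h1, h2⟩ := hL0.bounds hD.isUnit hr hrs hδ hθ
    constructor
    · have hle : ((Bracketing.quadProc L D V (-δ) (-w) θ θs ω - Bracketing.llr L θ θs ω : ℝ) :
          EReal) ≤ Bracketing.errLower P Θ θs L V w r ω := by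
        refine le_trans (EReal.coe_le_coe_iff.2 ?_) (le_iSup₂_of_le θ hθ le_rfl)
        -- Expanding the square of the root splits off the `V`-penalty of the error; the `D`-part is
        -- compared with the mean through `h2`.
        rw [Bracketing.quadProc, Bracketing.norm_app_Deps_sq hD.1 hV.1 hposneg.posSemidef]
        linarith
      rw [EReal.sub_le_iff_le_add (by simp) (by simp), add_comm]
      have h4 := add_le_add_left hle (Bracketing.llr L θ θs ω : EReal)
      rwa [← EReal.coe_add, sub_add_cancel] at h4
    · have hle : ((Bracketing.llr L θ θs ω - Bracketing.quadProc L D V δ w θ θs ω : ℝ) :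
          EReal) ≤ Bracketing.errUpper P Θ θs L V w r ω := by
        refine le_trans (EReal.coe_le_coe_iff.2 ?_) (le_iSup₂_of_le θ hθ le_rfl)
        rw [Bracketing.quadProc, Bracketing.norm_app_Deps_sq hD.1 hV.1 hpos]
        linarith
      have h4 := add_le_add_right hle (Bracketing.quadProc L D V δ w θ θs ω : EReal)
      rwa [← EReal.coe_add, add_sub_cancel] at h4
  · rw [Bracketing.errUpper_eq hθs hint (hgrad ω), Bracketing.errLower_eq hθs hint (hgrad ω)]
    exact ⟨Bracketing.penalizedSup_nonneg hs _ _, Bracketing.penalizedSup_nonneg hs _ _⟩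
  · filter_upwards [
      Bracketing.ae_penalizedSup_lt_top hED1 hmeas hV.isUnit hν0 hg hw0.le hr hrs hconv hθs hdiff
        (σ := 1) (by simp),
      Bracketing.ae_penalizedSup_lt_top hED1 hmeas hV.isUnit hν0 hg hw0.le hr hrs hconv hθs hdiff
        (σ := -1) (by simp)] with ω hup hlow
    rw [Bracketing.errUpper_eq hθs hint (hgrad ω), Bracketing.errLower_eq hθs hint (hgrad ω)]
    exact ⟨hup, hlow⟩
  · simp only [fun ω => Bracketing.errUpper_eq (V := V) (w := w) (r := r) hθs hint (hgrad ω),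
      fun ω => Bracketing.errLower_eq (V := V) (w := w) (r := r) hθs hint (hgrad ω)]
    exact ⟨Bracketing.measure_zQ_le_penalizedSup_le hp hED1 hmeas hV.isUnit hν0 hr hrs hconv hθs
        hdiff hw h3 hx (by simp),
      Bracketing.measure_zQ_le_penalizedSup_le hp hED1 hmeas hV.isUnit hν0 hr hrs hconv hθs
        hdiff hw h3 hx (by simp)⟩
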